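/- Let $T>0$, let $m\ge 1$, let $\alpha_0>\alpha_1>\dots>\alpha_m\ge 0$ be real numbers, and let $n_i$ be the nonnegative integer with $n_i-1<\alpha_i\le n_i$ ($i=0,\dots,m$). For $\alpha>0$ let $I_{0+}^{\alpha}f(t)=\frac1{\Gamma(\alpha)}\int_0^t(t-\tau)^{\alpha-1}f(\tau)\,d\tau$, and let $I_{0+}^0f=f$. For $n-1<\alpha\le n$ with $n$ a nonnegative integer let $D_{0+}^{\alpha}f=\frac{d^n}{dt^n}I_{0+}^{n-\alpha}f$ on $(0,T]$ (Riemann–Liouville derivative) and ${}^cD_{0+}^{\alpha}f=D_{0+}^{\alpha}\bigl[f-\sum_{k=0}^{n-1}\frac{f^{(k)}(0)}{k!}t^k\bigr]$ (Caputo derivative); at the endpoints of $[0,T]$ ordinary derivatives are one-sided. Let $C^{\alpha,r}[0,T]$ be the space of all $f\in C^r[0,T]$ such that ${}^cD_{0+}^{\alpha}f$ exists on $(0,T]$ and extends to a continuous function on $[0,T]$, with the norm $\sum_{k=0}^{r}\|f^{(k)}\|_{\infty}+\|{}^cD_{0+}^{\alpha}f\|_{\infty}$. Consider the equation $${}^cD_{0+}^{\alpha_0}y(t)=-\sum_{i=1}^m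 a_i(t)\,{}^cD_{0+}^{\alpha_i}y(t),\qquad 0<t<T. \tag{1}$$ A canonical fundamental system of (1) is a system of solutions $y_0,\dots,y_{n_0-1}$ of (1) such that, for all $j,k\in\{0,\dots,n_0-1\}$, $y_j^{(k)}(+0)=1$ if $j=k$ and $y_j^{(k)}(+0)=0$ if $j\ne k$. For $0\le j\le n_0-1$ put $H_j=\{i\in\{1,\dots,m\}:0\le\alpha_i\le j\}$ and, if $H_j\neq\emptyset$, $h_j=\min H_j$. Put $\Phi_{j+1}(t)=t^j/j!$ and $\Phi_{j+1-\alpha_i}:=D_{0+}^{\alpha_i}\Phi_{j+1}$. **Theorem 2.** Assume that $n_0>n_1$, that $a_i\in C[0,T]$ for $i=1,\dots,m$, and that $H_0\ne\emptyset$ (that is, $\alpha_m=0$). Then (1) has a unique canonical fundamental system $y_0,\dots,y_{n_0-1}$ with all $y_j\in C^{\alpha_0,n_0-1}[0,T]$. It is given on $[0,T]$ by $$y_j(t)=\Phi_{j+1}(t)+\sum_{k=0}^{\infty}(-1)^{k+1}I_{0+}^{\alpha_0}\Bigl[\sum_{i=1}^m a_i(t)I_{0+}^{\alpha_0-\alpha_i}\Bigr]^k\sum_{i=h_j}^m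 a_i(t)\Phi_{j+1-\alpha_i}(t),\qquad j=0,\dots,n_1-1, \tag{11}$$ $$y_j(t)=\Phi_{j+1}(t)+\sum_{k=0}^{\infty}(-1)^{k+1}I_{0+}^{\alpha_0}\Bigl[\sum_{i=1}^m a_i(t)I_{0+}^{\alpha_0-\alpha_i}\Bigr]^k\sum_{i=1}^m a_i(t)\Phi_{j+1-\alpha_i}(t),\qquad j=n_1,\dots,n_0-1. \tag{12}$$ The series converge absolutely at every point of $[0,T]$, and their partial sums (with $\Phi_{j+1}$ added) converge to $y_j$ in the norm of $C^{\alpha_0,n_0-1}[0,T]$. -/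

import Mathlib

open Set Filter Topology

noncomputable section

namespace CaputoODE

/-- Riemann-Liouville fractional integral of order `α ≥ 0` based at `0`; `I^0 f = f`. -/
def fracInt (α : ℝ) (f : ℝ → ℝ) (t : ℝ) : ℝ :=
  if α = 0 then f t
  else (1 / Real.Gamma α) * ∫ τ in (0 : ℝ)..t, (t - τ) ^ (α - 1) * f τ

/-- Riemann-Liouville fractional derivative of order `α ≥ 0` of a function on `(0, T]`: with
`n = ⌈α⌉₊` (so `n - 1 < α ≤ n`), the `n`-th derivative of `I^(n - α) f` (one-sided at `T`). -/
def rlDeriv (T α : ℝ) (f : ℝ → ℝ) (t : ℝ) : ℝ :=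
  iteratedDerivWithin ⌈α⌉₊ (fracInt (⌈α⌉₊ - α) f) (Ioc 0 T) t

/-- The Riemann-Liouville derivative of order `α` exists at every point of `S ⊆ (0, T]`:
`I^(n - α) f` is `n` times differentiable there. -/
def RLDifferentiableOn (T α : ℝ) (f : ℝ → ℝ) (S : Set ℝ) : Prop :=
  ∀ k < ⌈α⌉₊, ∀ t ∈ S, DifferentiableWithinAt ℝ
    (iteratedDerivWithin k (fracInt (⌈α⌉₊ - α) f) (Ioc 0 T)) (Ioc 0 T) t

/-- `f` minus its Taylor polynomial at `0` of degree `< n`, the derivatives at `0` being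
one-sided derivatives of `f` on `[0, T]`. -/
def subTaylor (T : ℝ) (n : ℕ) (f : ℝ → ℝ) (t : ℝ) : ℝ :=
  f t - ∑ k ∈ Finset.range n, iteratedDerivWithin k f (Icc 0 T) 0 / (k.factorial : ℝ) * t ^ k

/-- Caputo fractional derivative of order `α ≥ 0` on `(0, T]`. -/
def caputoDeriv (T α : ℝ) (f : ℝ → ℝ) (t : ℝ) : ℝ :=
  rlDeriv T α (subTaylor T ⌈α⌉₊ f) t

/-- Existence of the Caputo derivative of order `α` at every point of `S ⊆ (0, T]`. -/
def CaputoDifferentiableOn (T α : ℝ) (f : ℝ → ℝ) (S : Set ℝ) : Prop :=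
  RLDifferentiableOn T α (subTaylor T ⌈α⌉₊ f) S

/-- The space `C^{α, r}[0, T]` of functions in `C^r[0, T]` whose Caputo derivative of order `α`
exists on `(0, T]` and is (extends to) a continuous function on `[0, T]`. -/
def MemCaputoSpace (T α : ℝ) (r : ℕ) (f : ℝ → ℝ) : Prop :=
  ContDiffOn ℝ r f (Icc 0 T) ∧
  CaputoDifferentiableOn T α f (Ioc 0 T) ∧
  ∃ v : ℝ → ℝ, ContinuousOn v (Icc 0 T) ∧ ∀ t ∈ Ioc 0 T, caputoDeriv T α f t = v t

/-- Convergence in the norm `∑_{k ≤ r} ‖f^(k)‖_∞ + ‖ᶜD^α f‖_∞` of `C^{α, r}[0, T]`. -/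
def TendstoCaputoSpace (T α : ℝ) (r : ℕ) (F : ℕ → ℝ → ℝ) (f : ℝ → ℝ) : Prop :=
  (∀ N, MemCaputoSpace T α r (F N)) ∧ MemCaputoSpace T α r f ∧
  (∀ k ≤ r, TendstoUniformlyOn (fun N => iteratedDerivWithin k (F N) (Icc 0 T))
    (iteratedDerivWithin k f (Icc 0 T)) atTop (Icc 0 T)) ∧
  TendstoUniformlyOn (fun N => caputoDeriv T α (F N)) (caputoDeriv T α f) atTop (Ioc 0 T)

/-- `y` solves `ᶜD^{α_0} y = - ∑_{i=1}^m a_i ᶜD^{α_i} y` on `(0, T)`, all the derivatives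
existing there. -/
def IsSolution (T : ℝ) (m : ℕ) (α : ℕ → ℝ) (a : ℕ → ℝ → ℝ) (y : ℝ → ℝ) : Prop :=
  (∀ i ≤ m, CaputoDifferentiableOn T (α i) y (Ioo 0 T)) ∧
  ∀ t ∈ Ioo 0 T,
    caputoDeriv T (α 0) y t = -∑ i ∈ Finset.Icc 1 m, a i t * caputoDeriv T (α i) y t

/-- Canonical fundamental system: solutions `y_0, …, y_{n₀-1}` with
`D^k y_j(t)|_{t = +0} = δ_{jk}`. -/
def IsCanonicalFundamentalSystem (T : ℝ) (m : ℕ) (α : ℕ → ℝ) (a : ℕ → ℝ → ℝ) {n₀ : ℕ}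
    (y : Fin n₀ → ℝ → ℝ) : Prop :=
  ∀ j : Fin n₀, IsSolution T m α a (y j) ∧
    ∀ k : Fin n₀, Tendsto (iteratedDerivWithin k (y j) (Icc 0 T)) (𝓝[>] 0)
      (𝓝 (if j = k then 1 else 0))

/-- The index set `H_j = {i ∈ {1, …, m} : 0 ≤ α_i ≤ j}`. -/
def H (m : ℕ) (α : ℕ → ℝ) (j : ℕ) : Set ℕ :=
  {i | i ∈ Icc 1 m ∧ 0 ≤ α i ∧ α i ≤ j}

/-- `h_j = min H_j`, used only when `H_j` is nonempty. -/
def h (m : ℕ) (α : ℕ → ℝ) (j : ℕ) : ℕ := sInf (H m α j)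

/-- `Φ_{j+1}(t) = t^j / j!`. -/
def Phi (j : ℕ) (t : ℝ) : ℝ := t ^ j / (j.factorial : ℝ)

/-- `Φ_{j+1-β} := D^β Φ_{j+1}` (Riemann-Liouville derivative). -/
def PhiFrac (T : ℝ) (j : ℕ) (β : ℝ) : ℝ → ℝ := rlDeriv T β (Phi j)

/-- The operator `g ↦ ∑_{i=1}^m a_i I^{α_0 - α_i} g`. -/
def opA (m : ℕ) (α : ℕ → ℝ) (a : ℕ → ℝ → ℝ) (g : ℝ → ℝ) (t : ℝ) : ℝ :=
  ∑ i ∈ Finset.Icc 1 m, a i t * fracInt (α 0 - α i) g t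

/-- The `k`-th term of the series for `y_j`, where the inner sum runs over `i = p, …, m`:
`(-1)^(k+1) I^{α_0} [∑_{i=1}^m a_i I^{α_0-α_i}]^k ∑_{i=p}^m a_i Φ_{j+1-α_i}`. -/
def seriesTerm (T : ℝ) (m : ℕ) (α : ℕ → ℝ) (a : ℕ → ℝ → ℝ) (p j k : ℕ) (t : ℝ) : ℝ :=
  (-1) ^ (k + 1) * fracInt (α 0)
    ((opA m α a)^[k] (fun s => ∑ i ∈ Finset.Icc p m, a i s * PhiFrac T j (α i) s)) t

/-- On `[0, T]`, `y = Φ_{j+1} + ∑_{k ≥ 0} seriesTerm k`: the series converges pointwise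
on `[0, T]` with this sum, and its partial sums converge in `C^{α_0, r}[0, T]`. -/
def IsSeries (T : ℝ) (m : ℕ) (α : ℕ → ℝ) (a : ℕ → ℝ → ℝ) (r p j : ℕ) (y : ℝ → ℝ) : Prop :=
  (∀ t ∈ Icc 0 T, Summable (fun k => seriesTerm T m α a p j k t) ∧
    y t = Phi j t + ∑' k, seriesTerm T m α a p j k t) ∧
  TendstoCaputoSpace T (α 0) r
    (fun N t => Phi j t + ∑ k ∈ Finset.range N, seriesTerm T m α a p j k t) y

end CaputoODE

end

open MeasureTheory

namespace CaputoODE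

/-! Seek `y_j` as `Phi j + fracInt (α 0) v`, where the density `v` is its Caputo derivative of order
`α 0`. By the semigroup law `fracInt_fracInt`, the derivative of order `α i` is then `caputoPhi j (α
i) + fracInt (α 0 - α i) v` (`caputoDeriv_of_eqOn_Phi_add`). The differential equation becomes the
Volterra equation `v = -(g + opA v)`, with `g = caputoPhiSum` built from the Caputo derivatives of
`Phi j`.

The orders `α 0 - α i` are positive, so `opA` is a contraction for the sup norm with weight `exp
(-lam * t)`, `lam` large (`exists_opA_weighted_bound`). The Neumann series therefore converges
uniformly to a solution `v` (`exists_neumann_series`), and applying `fracInt (α 0)` termwise yields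
the series for `y_j`. Conversely, any solution in the space with the same initial values has this
form (`eqOn_Phi_add_fracInt_of_caputoDeriv`), and the Volterra equation has only one continuous
solution.

The series are written with Riemann–Liouville derivatives of `Phi j`. Starting the inner sum at
`h_j` omits exactly the indices with `α i > j`, whose Caputo derivatives of `Phi j` vanish
(`sum_PhiFrac_eq_caputoPhiSum`). -/

/-! ### Fractional integrals: linearity, bounds, continuity. -/

theorem fracInt_zero (f : ℝ → ℝ) : fracInt 0 f = f := by
  funext t
  simp [fracInt]

theorem fracInt_of_pos {a : ℝ} (ha : 0 < a) (f : ℝ → ℝ) (t : ℝ) :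
    fracInt a f t = (1 / Real.Gamma a) * ∫ s in (0 : ℝ)..t, s ^ (a - 1) * f (t - s) := by
  have h := intervalIntegral.integral_comp_sub_left (a := 0) (b := t)
    (fun τ => (t - τ) ^ (a - 1) * f τ) t
  simp only [sub_self, sub_zero, sub_sub_cancel] at h
  rw [fracInt, if_neg ha.ne', h]

theorem fracInt_at_zero {a : ℝ} (ha : 0 < a) (f : ℝ → ℝ) : fracInt a f 0 = 0 := by
  simp [fracInt_of_pos ha]

theorem fracInt_one (f : ℝ → ℝ) (t : ℝ) : fracInt 1 f t = ∫ τ in (0 : ℝ)..t, f τ := by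
  simp [fracInt]

theorem fracInt_congr_Ioc {T a t : ℝ} {f g : ℝ → ℝ} (ha : 0 < a) (hfg : EqOn f g (Ioc 0 T))
    (ht : t ∈ Icc 0 T) : fracInt a f t = fracInt a g t := by
  rw [fracInt, fracInt, if_neg ha.ne', if_neg ha.ne']
  congr 1
  refine intervalIntegral.integral_congr_ae (ae_of_all _ fun s hs => ?_)
  rw [uIoc_of_le ht.1] at hs
  rw [hfg ⟨hs.1, hs.2.trans ht.2⟩]

theorem fracInt_congr {T a : ℝ} {f g : ℝ → ℝ} (ha : 0 ≤ a) (hfg : EqOn f g (Icc 0 T)) :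
    EqOn (fracInt a f) (fracInt a g) (Icc 0 T) := by
  intro t ht
  rcases ha.eq_or_lt with rfl | ha
  · rw [fracInt_zero, fracInt_zero, hfg ht]
  · exact fracInt_congr_Ioc ha (hfg.mono Ioc_subset_Icc_self) ht

theorem intervalIntegrable_fracInt_kernel {T a t : ℝ} {f : ℝ → ℝ} (ha : 0 < a)
    (hf : ContinuousOn f (Icc 0 T)) (ht : t ∈ Icc 0 T) :
    IntervalIntegrable (fun s => s ^ (a - 1) * f (t - s)) volume 0 t := by
  refine (intervalIntegral.intervalIntegrable_rpow' (by linarith)).mul_continuousOn ?_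
  refine hf.comp (by fun_prop) fun s hs => ?_
  rw [uIcc_of_le ht.1] at hs
  exact ⟨by linarith [hs.2], by linarith [hs.1, ht.2]⟩

theorem fracInt_add {T a t : ℝ} {f g : ℝ → ℝ} (ha : 0 ≤ a) (hf : ContinuousOn f (Icc 0 T))
    (hg : ContinuousOn g (Icc 0 T)) (ht : t ∈ Icc 0 T) :
    fracInt a (fun s => f s + g s) t = fracInt a f t + fracInt a g t := by
  rcases ha.eq_or_lt with rfl | ha
  · simp [fracInt_zero]
  · simp only [fracInt_of_pos ha, mul_add]
    rw [intervalIntegral.integral_add (intervalIntegrable_fracInt_kernel ha hf ht)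
      (intervalIntegrable_fracInt_kernel ha hg ht), mul_add]

theorem fracInt_const_mul (a c : ℝ) (f : ℝ → ℝ) (t : ℝ) :
    fracInt a (fun s => c * f s) t = c * fracInt a f t := by
  by_cases ha : a = 0
  · subst ha; simp [fracInt_zero]
  · simp only [fracInt, if_neg ha]
    rw [show (fun τ => (t - τ) ^ (a - 1) * (c * f τ)) = fun τ => c * ((t - τ) ^ (a - 1) * f τ) by
      funext τ; ring, intervalIntegral.integral_const_mul]
    ring

theorem fracInt_sub {T a t : ℝ} {f g : ℝ → ℝ} (ha : 0 ≤ a) (hf : ContinuousOn f (Icc 0 T))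
    (hg : ContinuousOn g (Icc 0 T)) (ht : t ∈ Icc 0 T) :
    fracInt a (fun s => f s - g s) t = fracInt a f t - fracInt a g t := by
  have h := fracInt_add ha hf (g := fun s => -1 * g s) (continuousOn_const.mul hg) ht
  rw [fracInt_const_mul] at h
  simpa [sub_eq_add_neg] using h

theorem fracInt_zero_fun (a t : ℝ) : fracInt a (fun _ => 0) t = 0 := by
  simpa using fracInt_const_mul a 0 (fun _ => 0) t

theorem fracInt_sum {T a t : ℝ} {F : ℕ → ℝ → ℝ} (ha : 0 ≤ a)
    (hF : ∀ k, ContinuousOn (F k) (Icc 0 T)) (ht : t ∈ Icc 0 T) (N : ℕ) :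
    fracInt a (fun s => ∑ k ∈ Finset.range N, F k s) t
      = ∑ k ∈ Finset.range N, fracInt a (F k) t := by
  induction N with
  | zero => simp [fracInt_zero_fun]
  | succ N ih =>
    simp only [Finset.sum_range_succ]
    rw [fracInt_add ha (continuousOn_finsetSum _ fun k _ => hF k) (hF N) ht, ih]

/-- The gain `lam ^ (-a)` is `∫₀^∞ s ^ (a - 1) * exp (-lam * s) ds / Γ(a)`. It tends to `0` as `lam
→ ∞` when `a > 0`, which is the source of the contraction. -/
theorem abs_fracInt_le {a lam M t : ℝ} {f : ℝ → ℝ} (ha : 0 ≤ a) (hlam : 0 < lam) (ht : 0 ≤ t)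
    (hM : 0 ≤ M) (hf : ∀ s ∈ Icc 0 t, |f s| ≤ M * Real.exp (lam * s)) :
    |fracInt a f t| ≤ lam ^ (-a) * M * Real.exp (lam * t) := by
  rcases ha.eq_or_lt with rfl | ha
  · simpa [fracInt_zero] using hf t ⟨ht, le_rfl⟩
  have hG := Real.Gamma_pos_of_pos ha
  have hint := Real.integral_rpow_mul_exp_neg_mul_Ioi ha hlam
  have hI : IntegrableOn (fun s : ℝ => s ^ (a - 1) * Real.exp (-(lam * s))) (Ioi 0) := by
    -- A non-integrable function has integral `0` by convention, so the nonzero Gamma value proves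
    -- integrability.
    refine Integrable.of_integral_ne_zero ?_
    rw [hint]
    positivity
  have hI' : IntegrableOn (fun s : ℝ => s ^ (a - 1) * Real.exp (-(lam * s))) (Ioc 0 t) :=
    hI.mono_set Ioc_subset_Ioi_self
  have key : |∫ s in (0 : ℝ)..t, s ^ (a - 1) * f (t - s)|
      ≤ M * Real.exp (lam * t) * ((1 / lam) ^ a * Real.Gamma a) := by
    rw [intervalIntegral.integral_of_le ht, ← hint, ← Real.norm_eq_abs]
    calc ‖∫ s in Ioc 0 t, s ^ (a - 1) * f (t - s)‖
        ≤ ∫ s in Ioc 0 t, M * Real.exp (lam * t) * (s ^ (a - 1) * Real.exp (-(lam * s))) := by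
          refine norm_integral_le_of_norm_le (hI'.const_mul _) ?_
          refine (ae_restrict_iff' measurableSet_Ioc).2 (ae_of_all _ fun s hs => ?_)
          have h1 : 0 ≤ s ^ (a - 1) := Real.rpow_nonneg hs.1.le _
          have h2 := hf (t - s) ⟨by linarith [hs.2], by linarith [hs.1]⟩
          rw [norm_mul, Real.norm_eq_abs, Real.norm_eq_abs, abs_of_nonneg h1]
          calc s ^ (a - 1) * |f (t - s)| ≤ s ^ (a - 1) * (M * Real.exp (lam * (t - s))) := by
                gcongr
            _ = _ := by
                rw [show lam * (t - s) = lam * t + -(lam * s) by ring, Real.exp_add]; ring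
      _ = M * Real.exp (lam * t) * ∫ s in Ioc 0 t, s ^ (a - 1) * Real.exp (-(lam * s)) :=
          integral_const_mul _ _
      _ ≤ _ := by
          refine mul_le_mul_of_nonneg_left ?_ (by positivity)
          refine setIntegral_mono_set hI ?_ Ioc_subset_Ioi_self.eventuallyLE
          refine (ae_restrict_iff' measurableSet_Ioi).2 (ae_of_all _ fun s hs => ?_)
          exact mul_nonneg (Real.rpow_nonneg (le_of_lt hs) _) (Real.exp_pos _).le
  rw [fracInt_of_pos ha, abs_mul, abs_of_pos (by positivity)]
  calc _ ≤ 1 / Real.Gamma a * (M * Real.exp (lam * t) * ((1 / lam) ^ a * Real.Gamma a)) := by gcongr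
    _ = (1 / lam) ^ a * M * Real.exp (lam * t) := by field_simp
    _ = _ := by rw [Real.rpow_neg hlam.le, one_div, Real.inv_rpow hlam.le]

theorem abs_fracInt_le_of_bound {T a M t : ℝ} {f : ℝ → ℝ} (ha : 0 ≤ a) (hM : 0 ≤ M)
    (hf : ∀ s ∈ Icc 0 T, |f s| ≤ M) (ht : t ∈ Icc 0 T) :
    |fracInt a f t| ≤ M * Real.exp T := by
  have h := abs_fracInt_le (f := f) ha one_pos ht.1 hM fun s hs =>
    (hf s ⟨hs.1, hs.2.trans ht.2⟩).trans (le_mul_of_one_le_right hM (Real.one_le_exp (by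
      simpa using hs.1)))
  simp only [Real.one_rpow, one_mul] at h
  exact h.trans (by gcongr; exact ht.2)

/-- Substituting `s = t * x` frees the limits and the singular factor from `t`, so that dominated
convergence gives continuity in `t`. -/
theorem fracInt_eq_unit_interval {a t : ℝ} (ha : 0 < a) (f : ℝ → ℝ) (ht : 0 ≤ t) :
    fracInt a f t
      = (1 / Real.Gamma a) * (t ^ a * ∫ x in (0 : ℝ)..1, x ^ (a - 1) * f (t - t * x)) := by
  rcases ht.eq_or_lt with rfl | ht
  · rw [fracInt_at_zero ha, Real.zero_rpow ha.ne']; simp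
  rw [fracInt_of_pos ha]
  congr 1
  have h := intervalIntegral.smul_integral_comp_mul_left (a := 0) (b := 1)
    (fun s => s ^ (a - 1) * f (t - s)) t
  rw [mul_zero, mul_one] at h
  rw [← h, smul_eq_mul, ← intervalIntegral.integral_const_mul,
    ← intervalIntegral.integral_const_mul]
  refine intervalIntegral.integral_congr fun x hx => ?_
  rw [uIcc_of_le zero_le_one] at hx
  rw [Real.mul_rpow ht.le hx.1, show a = a - 1 + 1 by ring, Real.rpow_add_one ht.ne']
  simp only [add_sub_cancel_right]
  ring

theorem continuousOn_fracInt {T a : ℝ} {f : ℝ → ℝ} (ha : 0 ≤ a)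
    (hf : ContinuousOn f (Icc 0 T)) : ContinuousOn (fracInt a f) (Icc 0 T) := by
  rcases ha.eq_or_lt with rfl | ha
  · rwa [fracInt_zero]
  rcases lt_or_ge T 0 with hT | hT
  · rw [Icc_eq_empty hT.not_ge]
    exact continuousOn_empty _
  obtain ⟨M, hM⟩ := isCompact_Icc.exists_bound_of_continuousOn hf
  have key : ContinuousOn (fun t => ∫ x in (0 : ℝ)..1, x ^ (a - 1) * f (t - t * x)) (Icc 0 T) := by
    have hmem : ∀ t ∈ Icc 0 T, ∀ x ∈ Ioc (0 : ℝ) 1, t - t * x ∈ Icc 0 T := fun t ht x hx =>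
      ⟨by nlinarith [ht.1, hx.2], by nlinarith [ht.1, hx.1, ht.2]⟩
    intro t ht
    refine intervalIntegral.continuousWithinAt_of_dominated_interval
      (bound := fun x => x ^ (a - 1) * M) ?_ ?_ ?_ ?_
    · filter_upwards [self_mem_nhdsWithin] with t ht
      rw [uIoc_of_le zero_le_one]
      refine ContinuousOn.aestronglyMeasurable ?_ measurableSet_Ioc
      refine ContinuousOn.mul (fun x hx => ?_) (hf.comp (by fun_prop) fun x hx => hmem t ht x hx)
      exact (Real.continuousAt_rpow_const _ _ (Or.inl hx.1.ne')).continuousWithinAt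
    · filter_upwards [self_mem_nhdsWithin] with t ht
      refine ae_of_all _ fun x hx => ?_
      rw [uIoc_of_le zero_le_one] at hx
      have h1 : 0 ≤ x ^ (a - 1) := Real.rpow_nonneg hx.1.le _
      rw [norm_mul, Real.norm_of_nonneg h1]
      exact mul_le_mul_of_nonneg_left (hM _ (hmem t ht x hx)) h1
    · exact (intervalIntegral.intervalIntegrable_rpow' (by linarith)).mul_const _
    · refine ae_of_all _ fun x hx => ?_
      rw [uIoc_of_le zero_le_one] at hx
      refine continuousWithinAt_const.mul ?_
      exact (hf.comp (by fun_prop) fun t ht => hmem t ht x hx : ContinuousOn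
        (fun t => f (t - t * x)) (Icc 0 T)) t ht
  refine (ContinuousOn.mul (f := fun _ => 1 / Real.Gamma a) continuousOn_const
    (ContinuousOn.mul (Real.continuous_rpow_const ha.le).continuousOn key)).congr fun t ht => ?_
  exact fracInt_eq_unit_interval ha f ht.1

theorem tendstoUniformlyOn_fracInt {T a : ℝ} {F : ℕ → ℝ → ℝ} {f : ℝ → ℝ} (ha : 0 ≤ a)
    (hF : ∀ N, ContinuousOn (F N) (Icc 0 T)) (hf : ContinuousOn f (Icc 0 T))
    (h : TendstoUniformlyOn F f atTop (Icc 0 T)) :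
    TendstoUniformlyOn (fun N => fracInt a (F N)) (fracInt a f) atTop (Icc 0 T) := by
  rw [Metric.tendstoUniformlyOn_iff] at h ⊢
  intro ε hε
  filter_upwards [h (ε / 2 / Real.exp T) (by positivity)] with N hN t ht
  rw [Real.dist_eq, ← fracInt_sub ha hf (hF N) ht]
  have := abs_fracInt_le_of_bound (f := fun s => f s - F N s) ha
    (by positivity : 0 ≤ ε / 2 / Real.exp T) (fun s hs => (hN s hs).le) ht
  rw [div_mul_cancel₀ _ (Real.exp_pos T).ne'] at this
  linarith

/-! ### The semigroup law, by convolution. -/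

theorem integral_rpow_mul_sub_rpow {a b t : ℝ} (ha : 0 < a) (hb : 0 < b) (ht : 0 < t) :
    ∫ s in (0 : ℝ)..t, s ^ (a - 1) * (t - s) ^ (b - 1)
      = t ^ (a + b - 1) * (Real.Gamma a * Real.Gamma b / Real.Gamma (a + b)) := by
  apply Complex.ofReal_injective
  have h := Complex.betaIntegral_scaled (a : ℂ) (b : ℂ) ht
  rw [Complex.betaIntegral_eq_Gamma_mul_div _ _ (by simpa using ha) (by simpa using hb)] at h
  rw [← intervalIntegral.integral_ofReal]
  have hpow : ((t ^ (a + b - 1) : ℝ) : ℂ) = (t : ℂ) ^ ((a : ℂ) + b - 1) := by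
    rw [Complex.ofReal_cpow ht.le]; push_cast; rfl
  rw [Complex.ofReal_mul, hpow]
  push_cast
  rw [← Complex.Gamma_ofReal, ← Complex.Gamma_ofReal, ← Complex.Gamma_ofReal]
  push_cast
  rw [← h]
  refine intervalIntegral.integral_congr fun s hs => ?_
  rw [uIcc_of_le ht.le] at hs
  rw [Complex.ofReal_cpow hs.1, Complex.ofReal_cpow (sub_nonneg.2 hs.2)]
  push_cast
  rfl

/-- The kernel `s ^ (a - 1) / Γ(a)` of the fractional integral, cut off outside `(0, T]`. -/
noncomputable def rlKernel (T a : ℝ) : ℝ → ℝ :=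
  indicator (Ioc 0 T) fun s => 1 / Real.Gamma a * s ^ (a - 1)

theorem rlKernel_of_nonpos {T a s : ℝ} (hs : s ≤ 0) : rlKernel T a s = 0 :=
  indicator_of_notMem (fun h => absurd h.1 hs.not_gt) _

theorem integrable_rlKernel {T a : ℝ} (hT : 0 ≤ T) (ha : 0 < a) :
    Integrable (rlKernel T a) := by
  refine IntegrableOn.integrable_indicator ?_ measurableSet_Ioc
  rw [← intervalIntegrable_iff_integrableOn_Ioc_of_le hT]
  exact (intervalIntegral.intervalIntegrable_rpow' (by linarith)).const_mul _

/-- The kernel lives on `s > 0`, so values of `G` beyond `T` never enter. This lets `G` be a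
truncated function or itself a convolution. -/
theorem convolution_rlKernel {T a t : ℝ} {g G : ℝ → ℝ} (ha : 0 < a) (ht : t ∈ Icc 0 T)
    (hG : ∀ s ≤ T, G s = indicator (Ici 0) g s) :
    convolution (rlKernel T a) G (ContinuousLinearMap.mul ℝ ℝ) volume t = fracInt a g t := by
  have h : (fun s => rlKernel T a s * G (t - s))
      = indicator (Ioc 0 t) fun s => 1 / Real.Gamma a * (s ^ (a - 1) * g (t - s)) := by
    funext s
    by_cases hs : 0 < s
    · rw [hG _ (by linarith [ht.2])]
      by_cases hst : s ≤ t
      · rw [rlKernel, indicator_of_mem (show s ∈ Ioc 0 T from ⟨hs, hst.trans ht.2⟩),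
          indicator_of_mem (show s ∈ Ioc 0 t from ⟨hs, hst⟩), indicator_of_mem (show t - s ∈ Ici 0 from sub_nonneg.2 hst), mul_assoc]
      · rw [indicator_of_notMem (show t - s ∉ Ici 0 from fun h => hst (sub_nonneg.1 h)),
          indicator_of_notMem (fun h => hst h.2), mul_zero]
    · rw [rlKernel_of_nonpos (not_lt.1 hs), indicator_of_notMem (fun h => hs h.1), zero_mul]
  simp only [convolution_def, ContinuousLinearMap.mul_apply']
  rw [h, integral_indicator measurableSet_Ioc, fracInt_of_pos ha,
    intervalIntegral.integral_of_le ht.1, integral_const_mul]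

theorem convolution_rlKernel_rlKernel {T a b t : ℝ} (ha : 0 < a) (hb : 0 < b) (ht : t ≤ T) :
    convolution (rlKernel T a) (rlKernel T b) (ContinuousLinearMap.mul ℝ ℝ) volume t
      = rlKernel T (a + b) t := by
  simp only [convolution_def, ContinuousLinearMap.mul_apply']
  rcases le_or_gt t 0 with ht0 | ht0
  · rw [rlKernel_of_nonpos ht0, ← integral_zero ℝ ℝ]
    congr 1
    funext s
    rcases le_or_gt s 0 with hs | hs
    · rw [rlKernel_of_nonpos hs, zero_mul]
    · rw [rlKernel_of_nonpos (by linarith : t - s ≤ 0), mul_zero]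
  have h : (fun s => rlKernel T a s * rlKernel T b (t - s))
      = indicator (Ioo 0 t) fun s => 1 / (Real.Gamma a * Real.Gamma b) *
        (s ^ (a - 1) * (t - s) ^ (b - 1)) := by
    funext s
    by_cases hs : s ∈ Ioo 0 t
    · rw [indicator_of_mem hs, rlKernel, rlKernel,
        indicator_of_mem (show s ∈ Ioc 0 T from ⟨hs.1, by linarith [hs.2]⟩),
        indicator_of_mem (show t - s ∈ Ioc 0 T from ⟨by linarith [hs.2], by linarith [hs.1]⟩)]
      simp only [one_div, mul_inv]
      ring
    · rw [indicator_of_notMem hs]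
      rcases le_or_gt s 0 with hs0 | hs0
      · rw [rlKernel_of_nonpos hs0, zero_mul]
      · rw [rlKernel_of_nonpos (a := b) (sub_nonpos.2 (not_lt.1 fun h => hs ⟨hs0, h⟩)), mul_zero]
  rw [h, integral_indicator measurableSet_Ioo, ← integral_Ioc_eq_integral_Ioo,
    ← intervalIntegral.integral_of_le ht0.le, intervalIntegral.integral_const_mul,
    integral_rpow_mul_sub_rpow ha hb ht0, rlKernel, indicator_of_mem (show t ∈ Ioc 0 T from ⟨ht0, ht⟩)]
  have h1 := (Real.Gamma_pos_of_pos ha).ne'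
  have h2 := (Real.Gamma_pos_of_pos hb).ne'
  field_simp

/-- Associativity of convolution, combined with the Beta integral that composes the two kernels. -/
theorem fracInt_fracInt_of_pos {T a b t : ℝ} {f : ℝ → ℝ} (ha : 0 < a) (hb : 0 < b)
    (hf : ContinuousOn f (Icc 0 T)) (ht : t ∈ Icc 0 T) :
    fracInt a (fracInt b f) t = fracInt (a + b) f t := by
  have hT : 0 ≤ T := ht.1.trans ht.2
  obtain ⟨M, hM⟩ := isCompact_Icc.exists_bound_of_continuousOn hf
  have hM0 : 0 ≤ M := (norm_nonneg _).trans (hM t ht)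
  set F : ℝ → ℝ := indicator (Icc 0 T) f with hFdef
  have hFint : Integrable F :=
    (hf.integrableOn_compact isCompact_Icc).integrable_indicator measurableSet_Icc
  have hFM : ∀ s, ‖F s‖ ≤ M := fun s => by
    rw [hFdef]
    by_cases hs : s ∈ Icc 0 T
    · rw [indicator_of_mem hs]; exact hM s hs
    · rw [indicator_of_notMem hs]; simpa using hM0
  have hFe : ∀ s ≤ T, F s = indicator (Ici 0) f s := fun s hs => by
    by_cases h0 : 0 ≤ s
    · rw [hFdef, indicator_of_mem (show s ∈ Icc 0 T from ⟨h0, hs⟩), indicator_of_mem (mem_Ici.2 h0)]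
    · rw [hFdef, indicator_of_notMem (fun h => h0 h.1), indicator_of_notMem (show s ∉ Ici 0 from h0)]
  have hKa := integrable_rlKernel hT ha
  have hKb := integrable_rlKernel hT hb
  have hassoc := convolution_assoc (f := rlKernel T a) (g := rlKernel T b) (k := F) (x₀ := t)
    (μ := volume) (ν := volume)
    (ContinuousLinearMap.mul ℝ ℝ) (ContinuousLinearMap.mul ℝ ℝ) (ContinuousLinearMap.mul ℝ ℝ)
    (ContinuousLinearMap.mul ℝ ℝ) (fun x y z => by simp [mul_assoc])
    hKa.aestronglyMeasurable hKb.aestronglyMeasurable hFint.aestronglyMeasurable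
    (hKa.ae_convolution_exists _ hKb) (hKb.norm.ae_convolution_exists _ hFint.norm) (by
      have hconv := (hKb.norm.integrable_convolution (ContinuousLinearMap.mul ℝ ℝ)
        hFint.norm).aestronglyMeasurable.comp_measurePreserving
          (Measure.measurePreserving_sub_left volume t)
      -- Since `F` is bounded by `M`, the inner convolution is bounded by `M` times the `L¹` norm of
      -- the second kernel.
      refine Integrable.mul_bdd (c := ∫ s, ‖rlKernel T b s‖ * M) hKa.norm hconv
        (ae_of_all _ fun x => ?_)
      simp only [convolution_def, ContinuousLinearMap.mul_apply']
      refine norm_integral_le_of_norm_le (hKb.norm.mul_const M) (ae_of_all _ fun s => ?_)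
      rw [norm_mul, norm_norm, norm_norm]
      exact mul_le_mul_of_nonneg_left (hFM _) (norm_nonneg _))
  rw [convolution_rlKernel (g := fracInt b f) ha ht] at hassoc
  · rw [← hassoc, ← convolution_rlKernel (by linarith : 0 < a + b) ht hFe]
    simp only [convolution_def (f := rlKernel T (a + b)), convolution_def (g := F),
      ContinuousLinearMap.mul_apply']
    congr 1
    funext s
    rcases le_or_gt s t with hs | hs
    · rw [convolution_rlKernel_rlKernel ha hb (hs.trans ht.2)]
    · rw [hFdef, indicator_of_notMem (fun h => by linarith [h.1]), mul_zero, mul_zero]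
  · intro s hs
    by_cases h0 : 0 ≤ s
    · rw [indicator_of_mem (mem_Ici.2 h0)]
      exact convolution_rlKernel hb ⟨h0, hs⟩ hFe
    · rw [indicator_of_notMem (show s ∉ Ici 0 from h0)]
      simp only [convolution_def, ContinuousLinearMap.mul_apply']
      rw [← integral_zero ℝ ℝ]
      congr 1
      funext x
      rcases le_or_gt x 0 with hx | hx
      · rw [rlKernel_of_nonpos hx, zero_mul]
      · rw [hFdef, indicator_of_notMem (fun h => by linarith [h.1, not_le.1 h0]), mul_zero]

theorem fracInt_fracInt {T a b : ℝ} {f : ℝ → ℝ} (ha : 0 ≤ a) (hb : 0 ≤ b)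
    (hf : ContinuousOn f (Icc 0 T)) :
    EqOn (fracInt a (fracInt b f)) (fracInt (a + b) f) (Icc 0 T) := by
  intro t ht
  rcases ha.eq_or_lt with rfl | ha
  · rw [fracInt_zero, zero_add]
  rcases hb.eq_or_lt with rfl | hb
  · rw [fracInt_zero, add_zero]
  exact fracInt_fracInt_of_pos ha hb hf ht

/-! ### Differentiating fractional integrals. -/

theorem hasDerivWithinAt_fracInt_one {T t : ℝ} {f : ℝ → ℝ} (hf : ContinuousOn f (Icc 0 T))
    (ht : t ∈ Icc 0 T) : HasDerivWithinAt (fracInt 1 f) (f t) (Icc 0 T) t := by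
  have hT : 0 ≤ T := ht.1.trans ht.2
  have hg : Continuous (IccExtend hT ((Icc 0 T).domRestrict f)) :=
    (continuousOn_iff_continuous_domRestrict.1 hf).Icc_extend'
  have hfg : EqOn f (IccExtend hT ((Icc 0 T).domRestrict f)) (Icc 0 T) := fun s hs => by
    rw [IccExtend_of_mem _ _ hs, domRestrict_apply]
  have h := (intervalIntegral.integral_hasDerivAt_right (hg.intervalIntegrable 0 t)
    hg.aestronglyMeasurable.stronglyMeasurableAtFilter hg.continuousAt).hasDerivWithinAt
    (s := Icc 0 T)
  rw [hfg ht]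
  refine h.congr_of_mem (fun s hs => ?_) ht
  rw [fracInt_congr zero_le_one hfg hs, fracInt_one]

theorem hasDerivWithinAt_fracInt {T b t : ℝ} {f : ℝ → ℝ} (hb : 0 ≤ b)
    (hf : ContinuousOn f (Icc 0 T)) (ht : t ∈ Icc 0 T) :
    HasDerivWithinAt (fracInt (b + 1) f) (fracInt b f t) (Icc 0 T) t := by
  refine (hasDerivWithinAt_fracInt_one (continuousOn_fracInt hb hf) ht).congr_of_mem
    (fun s hs => ?_) ht
  rw [fracInt_fracInt zero_le_one hb hf hs, add_comm]

/-- The set `s` is left free because ordinary derivatives are taken within `Icc 0 T`,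
Riemann–Liouville ones within `Ioc 0 T`. -/
theorem contDiffOn_fracInt {T : ℝ} {w : ℝ → ℝ} {s : Set ℝ} (hs : s ⊆ Icc 0 T)
    (hsu : UniqueDiffOn ℝ s) (hw : ContinuousOn w (Icc 0 T)) (k : ℕ) {b : ℝ} (hb : (k : ℝ) ≤ b) :
    ContDiffOn ℝ k (fracInt b w) s := by
  induction k generalizing b with
  | zero =>
    simp only [Nat.cast_zero] at hb ⊢
    exact contDiffOn_zero.2 ((continuousOn_fracInt hb hw).mono hs)
  | succ k ih =>
    push_cast at hb ⊢
    have hb0 : 0 ≤ b - 1 := by linarith [(Nat.cast_nonneg k : (0 : ℝ) ≤ k)]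
    have hd : ∀ t ∈ s, HasDerivWithinAt (fracInt b w) (fracInt (b - 1) w t) s t := fun t ht => by
      have := (hasDerivWithinAt_fracInt hb0 hw (hs ht)).mono hs
      rwa [sub_add_cancel] at this
    rw [contDiffOn_succ_iff_derivWithin hsu]
    refine ⟨fun t ht => (hd t ht).differentiableWithinAt, by simp, ?_⟩
    exact (ih (by linarith)).congr fun t ht => (hd t ht).derivWithin (hsu t ht)

theorem iteratedDerivWithin_fracInt {T : ℝ} {w : ℝ → ℝ} {s : Set ℝ} (hs : s ⊆ Icc 0 T)
    (hsu : UniqueDiffOn ℝ s) (hw : ContinuousOn w (Icc 0 T)) (k : ℕ) {b : ℝ} (hb : (k : ℝ) ≤ b) :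
    EqOn (iteratedDerivWithin k (fracInt b w) s) (fracInt (b - k) w) s := by
  induction k generalizing b with
  | zero => intro t _; simp
  | succ k ih =>
    push_cast at hb
    have hb0 : 0 ≤ b - 1 := by linarith [(Nat.cast_nonneg k : (0 : ℝ) ≤ k)]
    intro t ht
    have hd : EqOn (derivWithin (fracInt b w) s) (fracInt (b - 1) w) s := fun t ht => by
      have := (hasDerivWithinAt_fracInt hb0 hw (hs ht)).mono hs
      rw [sub_add_cancel] at this
      exact this.derivWithin (hsu t ht)
    rw [iteratedDerivWithin_succ', iteratedDerivWithin_congr hd ht, ih (by linarith) ht]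
    push_cast
    ring_nf

/-! ### The monomials `Phi j`. -/

theorem Phi_apply_zero (j : ℕ) : Phi j 0 = if j = 0 then 1 else 0 := by
  by_cases hj : j = 0
  · simp [Phi, hj]
  · simp [Phi, hj]

theorem hasDerivAt_Phi_succ (j : ℕ) (t : ℝ) : HasDerivAt (Phi (j + 1)) (Phi j t) t := by
  have h : HasDerivAt (Phi (j + 1)) _ t :=
    (hasDerivAt_pow (j + 1) t).div_const (((j + 1).factorial : ℕ) : ℝ)
  refine h.congr_deriv ?_
  simp only [Phi, Nat.factorial_succ]
  have h1 : ((j.factorial : ℕ) : ℝ) ≠ 0 := by positivity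
  have h2 : ((j : ℝ) + 1) ≠ 0 := by positivity
  push_cast
  field_simp

theorem contDiff_Phi (j : ℕ) (n : WithTop ℕ∞) : ContDiff ℝ n (Phi j) :=
  (contDiff_id.pow j).div_const _

theorem iteratedDerivWithin_Phi {s : Set ℝ} (hs : UniqueDiffOn ℝ s) (k j : ℕ) :
    EqOn (iteratedDerivWithin k (Phi j) s) (fun t => if k ≤ j then Phi (j - k) t else 0) s := by
  induction k generalizing j with
  | zero => intro t _; simp
  | succ k ih =>
    intro t ht
    rw [iteratedDerivWithin_succ']
    cases j with
    | zero =>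
      have h : derivWithin (Phi 0) s = fun _ => 0 := by
        rw [show Phi 0 = fun _ => (1 : ℝ) by funext x; simp [Phi]]
        funext x
        simp
      rw [h]
      simp
    | succ j =>
      have h : EqOn (derivWithin (Phi (j + 1)) s) (Phi j) s := fun x hx =>
        (hasDerivAt_Phi_succ j x).hasDerivWithinAt.derivWithin (hs x hx)
      rw [iteratedDerivWithin_congr h ht, ih j ht]
      simp

theorem Phi_eq_fracInt (T : ℝ) (j : ℕ) : EqOn (Phi j) (fracInt j fun _ => 1) (Icc 0 T) := by
  induction j with
  | zero => intro t _; simp [Phi, fracInt_zero]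
  | succ j ih =>
    intro t ht
    push_cast
    rw [add_comm (j : ℝ), ← fracInt_fracInt zero_le_one j.cast_nonneg continuousOn_const ht,
      ← fracInt_congr zero_le_one ih ht, fracInt_one,
      intervalIntegral.integral_eq_sub_of_hasDerivAt (fun x _ => hasDerivAt_Phi_succ j x)
        ((contDiff_Phi j 0).continuous.intervalIntegrable _ _), Phi_apply_zero]
    simp

/-! ### Riemann–Liouville and Caputo derivatives of `Phi j + fracInt A w`. -/

/-- Integrating by `⌈β⌉₊ - β` raises both orders to at least `⌈β⌉₊`, and then `⌈β⌉₊` derivatives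
lower them. The two summands serve for `Phi j`, a fractional integral of `1`, and for the density
term. -/
theorem rlDeriv_fracInt_add_fracInt {T β b c : ℝ} {u w g : ℝ → ℝ} (hβ : 0 ≤ β) (hb : β ≤ b)
    (hc : β ≤ c) (hu : ContinuousOn u (Icc 0 T)) (hw : ContinuousOn w (Icc 0 T))
    (hg : EqOn g (fun t => fracInt b u t + fracInt c w t) (Icc 0 T)) :
    RLDifferentiableOn T β g (Ioc 0 T) ∧
      EqOn (rlDeriv T β g) (fun t => fracInt (b - β) u t + fracInt (c - β) w t) (Ioc 0 T) := by
  have hsub : Ioc 0 T ⊆ Icc 0 T := Ioc_subset_Icc_self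
  have huniq := uniqueDiffOn_Ioc (0 : ℝ) T
  have hδ : 0 ≤ (⌈β⌉₊ : ℝ) - β := sub_nonneg.2 (Nat.le_ceil β)
  have hcb := continuousOn_fracInt (hβ.trans hb) hu
  have hcc := continuousOn_fracInt (hβ.trans hc) hw
  have key : EqOn (fracInt (⌈β⌉₊ - β) g)
      (fracInt (⌈β⌉₊ - β + b) u + fracInt (⌈β⌉₊ - β + c) w) (Ioc 0 T) := fun t ht => by
    rw [fracInt_congr hδ hg (hsub ht), fracInt_add hδ hcb hcc (hsub ht),
      fracInt_fracInt hδ (hβ.trans hb) hu (hsub ht), fracInt_fracInt hδ (hβ.trans hc) hw (hsub ht)]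
    rfl
  have h1 : ContDiffOn ℝ ⌈β⌉₊ (fracInt (⌈β⌉₊ - β + b) u) (Ioc 0 T) :=
    contDiffOn_fracInt hsub huniq hu _ (by linarith)
  have h2 : ContDiffOn ℝ ⌈β⌉₊ (fracInt (⌈β⌉₊ - β + c) w) (Ioc 0 T) :=
    contDiffOn_fracInt hsub huniq hw _ (by linarith)
  refine ⟨fun k hk t ht => ?_, fun t ht => ?_⟩
  · exact ((h1.add h2).congr key).differentiableOn_iteratedDerivWithin (by exact_mod_cast hk)
      huniq t ht
  · rw [rlDeriv, iteratedDerivWithin_congr key ht,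
      iteratedDerivWithin_add ht huniq (h1 t ht) (h2 t ht),
      iteratedDerivWithin_fracInt hsub huniq hu _ (by linarith) ht,
      iteratedDerivWithin_fracInt hsub huniq hw _ (by linarith) ht]
    simp only
    rw [show (⌈β⌉₊ : ℝ) - β + b - ⌈β⌉₊ = b - β by ring,
      show (⌈β⌉₊ : ℝ) - β + c - ⌈β⌉₊ = c - β by ring]

/-- The Caputo derivative of order `β` of `Phi j`, as a continuous function on `[0, T]`. -/
noncomputable def caputoPhi (j : ℕ) (β t : ℝ) : ℝ :=
  if (j : ℝ) < β then 0 else fracInt (j - β) (fun _ => 1) t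

theorem continuousOn_caputoPhi (T : ℝ) (j : ℕ) (β : ℝ) :
    ContinuousOn (caputoPhi j β) (Icc 0 T) := by
  unfold caputoPhi
  split_ifs with h
  · exact continuousOn_const
  · exact continuousOn_fracInt (by linarith) continuousOn_const

/-- Equality is claimed off `0` only, since `PhiFrac` differentiates within `Ioc 0 T`, which omits
`0`. -/
theorem PhiFrac_eq_caputoPhi {T β : ℝ} {j : ℕ} (hβ : 0 ≤ β) (hj : β ≤ j) :
    EqOn (PhiFrac T j β) (caputoPhi j β) (Ioc 0 T) := by
  intro t ht
  have h := (rlDeriv_fracInt_add_fracInt (g := Phi j) (T := T) hβ hj le_rfl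
    (continuousOn_const (c := 1)) (continuousOn_const (c := 0)) (fun t ht => by
      simp [Phi_eq_fracInt T j ht, fracInt_zero_fun])).2 ht
  rw [PhiFrac, h, caputoPhi, if_neg hj.not_gt]
  simp [fracInt_zero_fun]

section PhiAddFracInt

variable {T A : ℝ} {w F : ℝ → ℝ} {j : ℕ}

theorem contDiffOn_of_eqOn_Phi_add (hT : 0 < T) (hw : ContinuousOn w (Icc 0 T))
    (hF : EqOn F (fun t => Phi j t + fracInt A w t) (Icc 0 T)) {k : ℕ} (hk : (k : ℝ) ≤ A) :
    ContDiffOn ℝ k F (Icc 0 T) :=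
  ((contDiff_Phi j k).contDiffOn.add
    (contDiffOn_fracInt Subset.rfl (uniqueDiffOn_Icc hT) hw k hk)).congr hF

theorem iteratedDerivWithin_of_eqOn_Phi_add (hT : 0 < T) (hw : ContinuousOn w (Icc 0 T))
    (hF : EqOn F (fun t => Phi j t + fracInt A w t) (Icc 0 T)) {k : ℕ} (hk : (k : ℝ) ≤ A) :
    EqOn (iteratedDerivWithin k F (Icc 0 T))
      (fun t => iteratedDerivWithin k (Phi j) (Icc 0 T) t + fracInt (A - k) w t) (Icc 0 T) := by
  intro t ht
  have huniq := uniqueDiffOn_Icc hT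
  have hF' : EqOn F (Phi j + fracInt A w) (Icc 0 T) := hF
  rw [iteratedDerivWithin_congr hF' ht,
    iteratedDerivWithin_add ht huniq ((contDiff_Phi j k).contDiffOn t ht)
      (contDiffOn_fracInt Subset.rfl huniq hw k hk t ht),
    iteratedDerivWithin_fracInt Subset.rfl huniq hw k hk ht]

/-- Strictness of `k < A` leaves an integral of positive order, which vanishes at `0`; for `k = A`
the value `w 0` would appear. -/
theorem iteratedDerivWithin_zero_of_eqOn_Phi_add (hT : 0 < T) (hw : ContinuousOn w (Icc 0 T))
    (hF : EqOn F (fun t => Phi j t + fracInt A w t) (Icc 0 T)) {k : ℕ} (hk : (k : ℝ) < A) :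
    iteratedDerivWithin k F (Icc 0 T) 0 = if j = k then 1 else 0 := by
  have h0 : (0 : ℝ) ∈ Icc 0 T := ⟨le_rfl, hT.le⟩
  rw [iteratedDerivWithin_of_eqOn_Phi_add hT hw hF hk.le h0]
  simp only [iteratedDerivWithin_Phi (uniqueDiffOn_Icc hT) k j h0,
    fracInt_at_zero (sub_pos.2 hk), Phi_apply_zero]
  rcases lt_trichotomy j k with h | h | h
  · simp [h.not_ge, h.ne]
  · simp [h]
  · simp [h.le, h.ne', Nat.sub_eq_zero_iff_le, h.not_ge]

theorem subTaylor_of_eqOn {f : ℝ → ℝ} {n : ℕ}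
    (hf : ∀ k < n, iteratedDerivWithin k f (Icc 0 T) 0 = if j = k then 1 else 0) (t : ℝ) :
    subTaylor T n f t = f t - if j < n then Phi j t else 0 := by
  rw [subTaylor]
  congr 1
  calc _ = ∑ k ∈ Finset.range n, if j = k then Phi k t else 0 := by
        refine Finset.sum_congr rfl fun k hk => ?_
        rw [hf k (Finset.mem_range.1 hk), Phi]
        split_ifs <;> ring
    _ = _ := by simp [Finset.sum_ite_eq]

/-- The subtracted Taylor polynomial is `Phi j` when `j < β` and zero otherwise, so `Phi j` is
either killed or differentiated unchanged. -/
theorem caputoDeriv_of_eqOn_Phi_add (hT : 0 < T) (hw : ContinuousOn w (Icc 0 T))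
    (hF : EqOn F (fun t => Phi j t + fracInt A w t) (Icc 0 T)) {β : ℝ} (hβ : 0 ≤ β) (hβA : β ≤ A) :
    CaputoDifferentiableOn T β F (Ioc 0 T) ∧
      EqOn (caputoDeriv T β F) (fun t => caputoPhi j β t + fracInt (A - β) w t) (Ioc 0 T) := by
  have hsub : EqOn (subTaylor T ⌈β⌉₊ F)
      (fun t => (if (j : ℝ) < β then 0 else Phi j t) + fracInt A w t) (Icc 0 T) := by
    intro t ht
    rw [subTaylor_of_eqOn (j := j) (fun k hk => iteratedDerivWithin_zero_of_eqOn_Phi_add hT hw hF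
      ((Nat.lt_ceil.1 hk).trans_le hβA)), hF ht]
    simp only [Nat.lt_ceil]
    split_ifs <;> ring
  by_cases hj : (j : ℝ) < β
  · have h := rlDeriv_fracInt_add_fracInt (g := subTaylor T ⌈β⌉₊ F) hβ le_rfl hβA
      (continuousOn_const (c := 0)) hw (fun t ht => by
        simp [hsub ht, if_pos hj, fracInt_zero_fun])
    refine ⟨h.1, fun t ht => ?_⟩
    rw [caputoDeriv, h.2 ht]
    simp [caputoPhi, if_pos hj, fracInt_zero_fun]
  · have h := rlDeriv_fracInt_add_fracInt (g := subTaylor T ⌈β⌉₊ F) hβ (not_lt.1 hj) hβA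
      (continuousOn_const (c := 1)) hw (fun t ht => by
        simp [hsub ht, if_neg hj, Phi_eq_fracInt T j ht])
    refine ⟨h.1, fun t ht => ?_⟩
    rw [caputoDeriv, h.2 ht]
    simp [caputoPhi, if_neg hj]

theorem memCaputoSpace_of_eqOn_Phi_add (hT : 0 < T) (hA : 0 ≤ A)
    (hw : ContinuousOn w (Icc 0 T))
    (hF : EqOn F (fun t => Phi j t + fracInt A w t) (Icc 0 T)) (hj : (j : ℝ) < A) {r : ℕ}
    (hr : (r : ℝ) ≤ A) :
    MemCaputoSpace T A r F ∧ EqOn (caputoDeriv T A F) w (Ioc 0 T) := by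
  have h := caputoDeriv_of_eqOn_Phi_add hT hw hF hA le_rfl
  have heq : EqOn (caputoDeriv T A F) w (Ioc 0 T) := fun t ht => by
    rw [h.2 ht]
    simp [caputoPhi, hj, fracInt_zero]
  exact ⟨⟨contDiffOn_of_eqOn_Phi_add hT hw hF hr, h.1, w, hw, heq⟩, heq⟩

end PhiAddFracInt

/-! ### Recovering a function from its Caputo derivative. -/

theorem eqOn_fracInt_one_of_hasDerivAt {T : ℝ} {q v : ℝ → ℝ} (hq : ContinuousOn q (Icc 0 T))
    (hv : ContinuousOn v (Icc 0 T)) (hd : ∀ t ∈ Ioo 0 T, HasDerivAt q (v t) t) (h0 : q 0 = 0) :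
    EqOn q (fracInt 1 v) (Icc 0 T) := by
  intro t ht
  have hsub : Icc 0 t ⊆ Icc 0 T := Icc_subset_Icc_right ht.2
  rw [fracInt_one, intervalIntegral.integral_eq_sub_of_hasDerivAt_of_le ht.1 (hq.mono hsub)
    (fun s hs => hd s ⟨hs.1, hs.2.trans_le ht.2⟩)
    ((hv.mono hsub).intervalIntegrable_of_Icc ht.1), h0, sub_zero]

theorem eqOn_fracInt_iteratedDerivWithin {T : ℝ} (hT : 0 < T) (N : ℕ) {f : ℝ → ℝ}
    (hf : ContDiffOn ℝ N f (Icc 0 T))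
    (h0 : ∀ k < N, iteratedDerivWithin k f (Icc 0 T) 0 = 0) :
    EqOn f (fracInt N (iteratedDerivWithin N f (Icc 0 T))) (Icc 0 T) := by
  have huniq := uniqueDiffOn_Icc hT
  induction N generalizing f with
  | zero => intro t _; simp [fracInt_zero]
  | succ N ih =>
    intro t ht
    have hf' : ContDiffOn ℝ N (derivWithin f (Icc 0 T)) (Icc 0 T) :=
      hf.derivWithin huniq (by push_cast; exact le_rfl)
    have hdiff : DifferentiableOn ℝ f (Icc 0 T) := hf.differentiableOn (by simp)
    have h1 := eqOn_fracInt_one_of_hasDerivAt hf.continuousOn hf'.continuousOn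
      (fun t ht => (hdiff t (Ioo_subset_Icc_self ht)).hasDerivWithinAt.hasDerivAt
        (Icc_mem_nhds ht.1 ht.2)) (by simpa using h0 0 N.succ_pos)
    have h2 := ih hf' fun k hk => by
      rw [← iteratedDerivWithin_succ']; exact h0 (k + 1) (by omega)
    rw [h1 ht, fracInt_congr zero_le_one h2 ht, fracInt_fracInt zero_le_one N.cast_nonneg
      (hf'.continuousOn_iteratedDerivWithin le_rfl huniq) ht, iteratedDerivWithin_succ']
    push_cast
    rw [add_comm]

/-- A function of `C^{A, r}[0, T]`, `r = ⌈A⌉ - 1`, whose Taylor coefficients at `0` are those of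
`Phi j`, is recovered from its Caputo derivative by fractional integration. -/
theorem eqOn_Phi_add_fracInt_of_caputoDeriv {T A : ℝ} (hT : 0 < T) {r j : ℕ}
    (hr : ⌈A⌉₊ = r + 1) (hj : j < ⌈A⌉₊) {z v : ℝ → ℝ} (hz : ContDiffOn ℝ r z (Icc 0 T))
    (hd : CaputoDifferentiableOn T A z (Ioc 0 T)) (hv : ContinuousOn v (Icc 0 T))
    (hzv : EqOn (caputoDeriv T A z) v (Ioc 0 T))
    (h0 : ∀ k < ⌈A⌉₊, iteratedDerivWithin k z (Icc 0 T) 0 = if j = k then 1 else 0) :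
    EqOn z (fun t => Phi j t + fracInt A v t) (Icc 0 T) := by
  have huniq := uniqueDiffOn_Icc hT
  have huniq' := uniqueDiffOn_Ioc (0 : ℝ) T
  have hzero : (0 : ℝ) ∈ Icc 0 T := ⟨le_rfl, hT.le⟩
  have hr0 : (⌈A⌉₊ : ℝ) = r + 1 := by rw [hr]; push_cast; rfl
  set w : ℝ → ℝ := z - Phi j with hwdef
  have hsubT : subTaylor T ⌈A⌉₊ z = w := by
    funext t
    rw [subTaylor_of_eqOn h0, if_pos hj]
    rfl
  rw [CaputoDifferentiableOn, hsubT] at hd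
  have hPhi : ContDiffOn ℝ r (Phi j) (Icc 0 T) := (contDiff_Phi j r).contDiffOn
  have hw : ContDiffOn ℝ r w (Icc 0 T) := hz.sub hPhi
  have hw0 : ∀ k < r + 1, iteratedDerivWithin k w (Icc 0 T) 0 = 0 := by
    intro k hk
    have hkr : (k : WithTop ℕ∞) ≤ r := by exact_mod_cast Nat.lt_succ_iff.1 hk
    rw [hwdef, iteratedDerivWithin_sub hzero huniq ((hz.of_le hkr) 0 hzero)
      ((hPhi.of_le hkr) 0 hzero), h0 k (hr ▸ hk), iteratedDerivWithin_Phi huniq k j hzero]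
    simp only [Phi_apply_zero]
    rcases lt_trichotomy j k with h | h | h
    · simp [h.not_ge, h.ne]
    · simp [h]
    · simp [h.le, h.ne', Nat.sub_eq_zero_iff_le, h.not_ge]
  set W := iteratedDerivWithin r w (Icc 0 T) with hWdef
  have hWc : ContinuousOn W (Icc 0 T) := hw.continuousOn_iteratedDerivWithin le_rfl huniq
  have hwW : EqOn w (fracInt r W) (Icc 0 T) :=
    eqOn_fracInt_iteratedDerivWithin hT r hw fun k hk => hw0 k (by omega)
  obtain ⟨δ, hδ⟩ : ∃ δ : ℝ, δ = ⌈A⌉₊ - A := ⟨_, rfl⟩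
  have hδ0 : 0 ≤ δ := by linarith [Nat.le_ceil A]
  have hδ1 : 0 ≤ 1 - δ := by
    have : (r : ℝ) < A := Nat.lt_ceil.1 (by omega)
    linarith
  -- As `w = fracInt r W`, the first `r` derivatives pass through `fracInt δ`; one derivative
  -- remains in the definition of `ᶜD^A z = v`.
  have hq : EqOn (iteratedDerivWithin r (fracInt δ w) (Ioc 0 T)) (fracInt δ W) (Ioc 0 T) := by
    intro t ht
    have h1 : EqOn (fracInt δ w) (fracInt (δ + r) W) (Ioc 0 T) := fun s hs => by
      rw [fracInt_congr hδ0 hwW (Ioc_subset_Icc_self hs),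
        fracInt_fracInt hδ0 r.cast_nonneg hWc (Ioc_subset_Icc_self hs)]
    rw [iteratedDerivWithin_congr h1 ht,
      iteratedDerivWithin_fracInt Ioc_subset_Icc_self huniq' hWc r (by linarith) ht,
      add_sub_cancel_right]
  have hqd : ∀ t ∈ Ioo 0 T, HasDerivAt (fracInt δ W) (v t) t := by
    intro t ht
    have ht' := Ioo_subset_Ioc_self ht
    have h1 := (hd r (by omega) t ht').hasDerivWithinAt
    rw [← hδ, ← iteratedDerivWithin_succ] at h1
    have h2 : iteratedDerivWithin (r + 1) (fracInt δ w) (Ioc 0 T) t = v t := by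
      rw [← hzv ht', caputoDeriv, rlDeriv, hsubT, ← hδ, hr]
    rw [h2] at h1
    exact (h1.congr_of_mem (fun s hs => (hq hs).symm) ht').hasDerivAt (Ioc_mem_nhds ht.1 ht.2)
  have hq0 : fracInt δ W 0 = 0 := by
    rcases hδ0.eq_or_lt with h | h
    · rw [← h, fracInt_zero]; exact hw0 r (by omega)
    · exact fracInt_at_zero h W
  have hq1 := eqOn_fracInt_one_of_hasDerivAt (continuousOn_fracInt hδ0 hWc) hv hqd hq0
  -- Abel inversion: apply `fracInt (1 - δ)` to `fracInt δ W = fracInt 1 v`, then differentiate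
  -- once.
  have hWv : EqOn W (fracInt (1 - δ) v) (Icc 0 T) := by
    intro t ht
    have hI : EqOn (fracInt 1 W) (fracInt (1 - δ + 1) v) (Icc 0 T) := fun s hs => by
      rw [← fracInt_fracInt hδ1 zero_le_one hv hs, ← fracInt_congr hδ1 hq1 hs,
        fracInt_fracInt hδ1 hδ0 hWc hs, sub_add_cancel]
    exact (huniq t ht).eq_deriv _ (hasDerivWithinAt_fracInt_one hWc ht)
      ((hasDerivWithinAt_fracInt hδ1 hv ht).congr_of_mem hI ht)
  intro t ht
  have hwt : w t = fracInt A v t := by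
    rw [hwW ht, fracInt_congr r.cast_nonneg hWv ht, fracInt_fracInt r.cast_nonneg hδ1 hv ht]
    congr 1
    linarith
  simp only [← hwt, hwdef, Pi.sub_apply]
  ring

/-! ### The Volterra operator `opA` and its Neumann series. -/

section Volterra

variable {T : ℝ} {m : ℕ} {α : ℕ → ℝ} {a : ℕ → ℝ → ℝ}

theorem continuousOn_opA (hα : ∀ i ∈ Icc 1 m, α i < α 0)
    (ha : ∀ i ∈ Icc 1 m, ContinuousOn (a i) (Icc 0 T)) {g : ℝ → ℝ}
    (hg : ContinuousOn g (Icc 0 T)) : ContinuousOn (opA m α a g) (Icc 0 T) := by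
  refine continuousOn_finsetSum _ fun i hi => ?_
  rw [Finset.mem_Icc] at hi
  exact (ha i hi).mul (continuousOn_fracInt (sub_nonneg.2 (hα i hi).le) hg)

theorem continuousOn_opA_iterate (hα : ∀ i ∈ Icc 1 m, α i < α 0)
    (ha : ∀ i ∈ Icc 1 m, ContinuousOn (a i) (Icc 0 T)) {g : ℝ → ℝ}
    (hg : ContinuousOn g (Icc 0 T)) (k : ℕ) : ContinuousOn ((opA m α a)^[k] g) (Icc 0 T) := by
  induction k with
  | zero => exact hg
  | succ k ih =>
    rw [Function.iterate_succ_apply']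
    exact continuousOn_opA hα ha ih

/-- Integrals of positive order ignore the value at `0`, so the uncontrolled value of `PhiFrac`
there is harmless. -/
theorem opA_congr_Ioc (hα : ∀ i ∈ Icc 1 m, α i < α 0) {f g : ℝ → ℝ}
    (hfg : EqOn f g (Ioc 0 T)) : EqOn (opA m α a f) (opA m α a g) (Icc 0 T) := by
  intro t ht
  refine Finset.sum_congr rfl fun i hi => ?_
  rw [fracInt_congr_Ioc (sub_pos.2 (hα i (Finset.mem_Icc.1 hi))) hfg ht]

theorem opA_iterate_congr_Ioc (hα : ∀ i ∈ Icc 1 m, α i < α 0) {f g : ℝ → ℝ}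
    (hfg : EqOn f g (Ioc 0 T)) (k : ℕ) :
    EqOn ((opA m α a)^[k] f) ((opA m α a)^[k] g) (Ioc 0 T) := by
  induction k with
  | zero => exact hfg
  | succ k ih =>
    rw [Function.iterate_succ_apply', Function.iterate_succ_apply']
    exact (opA_congr_Ioc hα ih).mono Ioc_subset_Icc_self

theorem opA_sub (hα : ∀ i ∈ Icc 1 m, α i < α 0) {f g : ℝ → ℝ} (hf : ContinuousOn f (Icc 0 T))
    (hg : ContinuousOn g (Icc 0 T)) {t : ℝ} (ht : t ∈ Icc 0 T) :
    opA m α a (fun s => f s - g s) t = opA m α a f t - opA m α a g t := by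
  simp only [opA, ← Finset.sum_sub_distrib]
  refine Finset.sum_congr rfl fun i hi => ?_
  rw [fracInt_sub (sub_nonneg.2 (hα i (Finset.mem_Icc.1 hi)).le) hf hg ht, mul_sub]

theorem opA_sum (hα : ∀ i ∈ Icc 1 m, α i < α 0) {c : ℕ → ℝ} {F : ℕ → ℝ → ℝ}
    (hF : ∀ k, ContinuousOn (F k) (Icc 0 T)) {t : ℝ} (ht : t ∈ Icc 0 T) (N : ℕ) :
    opA m α a (fun s => ∑ k ∈ Finset.range N, c k * F k s) t
      = ∑ k ∈ Finset.range N, c k * opA m α a (F k) t := by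
  simp only [opA, Finset.mul_sum]
  rw [Finset.sum_comm]
  refine Finset.sum_congr rfl fun i hi => ?_
  rw [fracInt_sum (F := fun k s => c k * F k s) (sub_nonneg.2 (hα i (Finset.mem_Icc.1 hi)).le)
    (fun k => continuousOn_const.mul (hF k)) ht, Finset.mul_sum]
  refine Finset.sum_congr rfl fun k _ => ?_
  rw [fracInt_const_mul]
  ring

theorem tendsto_opA (hα : ∀ i ∈ Icc 1 m, α i < α 0) {F : ℕ → ℝ → ℝ} {f : ℝ → ℝ}
    (hF : ∀ N, ContinuousOn (F N) (Icc 0 T)) (hf : ContinuousOn f (Icc 0 T))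
    (h : TendstoUniformlyOn F f atTop (Icc 0 T)) {t : ℝ} (ht : t ∈ Icc 0 T) :
    Tendsto (fun N => opA m α a (F N) t) atTop (𝓝 (opA m α a f t)) := by
  refine tendsto_finsetSum _ fun i hi => ?_
  exact ((tendstoUniformlyOn_fracInt (sub_nonneg.2 (hα i (Finset.mem_Icc.1 hi)).le) hF hf
    h).tendsto_at ht).const_mul _

/-- For a large exponential weight, `opA` is a contraction with factor `1 / 2`. -/
theorem exists_opA_weighted_bound (hα : ∀ i ∈ Icc 1 m, α i < α 0)
    (ha : ∀ i ∈ Icc 1 m, ContinuousOn (a i) (Icc 0 T)) :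
    ∃ lam : ℝ, 0 < lam ∧ ∀ (g : ℝ → ℝ) (M : ℝ), 0 ≤ M →
      (∀ s ∈ Icc 0 T, |g s| ≤ M * Real.exp (lam * s)) →
      ∀ t ∈ Icc 0 T, |opA m α a g t| ≤ M / 2 * Real.exp (lam * t) := by
  have hK : ∀ i, ∃ K, i ∈ Icc 1 m → ∀ t ∈ Icc 0 T, ‖a i t‖ ≤ K := fun i => by
    by_cases hi : i ∈ Icc 1 m
    · obtain ⟨K, hK⟩ := isCompact_Icc.exists_bound_of_continuousOn (ha i hi)
      exact ⟨K, fun _ => hK⟩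
    · exact ⟨0, fun h => absurd h hi⟩
  choose K hK using hK
  -- This sum bounds the weighted operator norm; it tends to `0` because every `α 0 - α i` is
  -- positive.
  have hlim : Tendsto (fun lam : ℝ => ∑ i ∈ Finset.Icc 1 m, K i * lam ^ (-(α 0 - α i))) atTop
      (𝓝 0) := by
    rw [show (0 : ℝ) = ∑ i ∈ Finset.Icc 1 m, K i * 0 by simp]
    exact tendsto_finsetSum _ fun i hi =>
      (tendsto_rpow_neg_atTop (sub_pos.2 (hα i (Finset.mem_Icc.1 hi)))).const_mul _
  obtain ⟨lam, hlam, hpos⟩ :=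
    ((hlim.eventually (ge_mem_nhds (by norm_num : (0 : ℝ) < 1 / 2))).and
      (eventually_gt_atTop 0)).exists
  refine ⟨lam, hpos, fun g M hM hg t ht => ?_⟩
  calc |opA m α a g t|
      ≤ ∑ i ∈ Finset.Icc 1 m, |a i t * fracInt (α 0 - α i) g t| := Finset.abs_sum_le_sum_abs _ _
    _ ≤ ∑ i ∈ Finset.Icc 1 m, K i * lam ^ (-(α 0 - α i)) * (M * Real.exp (lam * t)) := by
        refine Finset.sum_le_sum fun i hi => ?_
        rw [Finset.mem_Icc] at hi
        have h1 := hK i hi t ht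
        have h2 := abs_fracInt_le (f := g) (sub_nonneg.2 (hα i hi).le) hpos ht.1 hM
          fun s hs => hg s ⟨hs.1, hs.2.trans ht.2⟩
        rw [abs_mul, mul_assoc (K i), ← mul_assoc (lam ^ _)]
        exact mul_le_mul h1 h2 (abs_nonneg _) ((norm_nonneg _).trans h1)
    _ = (∑ i ∈ Finset.Icc 1 m, K i * lam ^ (-(α 0 - α i))) * (M * Real.exp (lam * t)) :=
        (Finset.sum_mul _ _ _).symm
    _ ≤ 1 / 2 * (M * Real.exp (lam * t)) := by gcongr
    _ = _ := by ring

theorem exists_exp_bound {lam : ℝ} (hlam : 0 ≤ lam) {g : ℝ → ℝ} (hg : ContinuousOn g (Icc 0 T)) :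
    ∃ M : ℝ, 0 ≤ M ∧ ∀ t ∈ Icc 0 T, |g t| ≤ M * Real.exp (lam * t) := by
  obtain ⟨M, hM⟩ := isCompact_Icc.exists_bound_of_continuousOn hg
  refine ⟨max M 0, le_max_right _ _, fun t ht => ((hM t ht).trans (le_max_left M 0)).trans ?_⟩
  exact le_mul_of_one_le_right (le_max_right _ _) (Real.one_le_exp (mul_nonneg hlam ht.1))

theorem exists_opA_iterate_bound (hα : ∀ i ∈ Icc 1 m, α i < α 0)
    (ha : ∀ i ∈ Icc 1 m, ContinuousOn (a i) (Icc 0 T)) {g : ℝ → ℝ}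
    (hg : ContinuousOn g (Icc 0 T)) :
    ∃ C : ℝ, 0 ≤ C ∧ ∀ k, ∀ t ∈ Icc 0 T, |(opA m α a)^[k] g t| ≤ C * (1 / 2) ^ k := by
  obtain ⟨lam, hlam, hA⟩ := exists_opA_weighted_bound hα ha
  obtain ⟨M, hM0, hM⟩ := exists_exp_bound hlam.le hg
  have key : ∀ k, ∀ t ∈ Icc 0 T, |(opA m α a)^[k] g t| ≤ M * (1 / 2) ^ k * Real.exp (lam * t) := by
    intro k
    induction k with
    | zero => simpa using hM
    | succ k ih =>
      intro t ht
      rw [Function.iterate_succ_apply']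
      refine (hA _ _ (by positivity) ih t ht).trans_eq ?_
      rw [pow_succ]
      ring
  refine ⟨M * Real.exp (lam * T), by positivity, fun k t ht => (key k t ht).trans ?_⟩
  rw [mul_right_comm]
  gcongr
  exact ht.2

/-- Each use of the equation halves the weighted bound on `d`. -/
theorem eqOn_zero_of_eqOn_neg_opA (hα : ∀ i ∈ Icc 1 m, α i < α 0)
    (ha : ∀ i ∈ Icc 1 m, ContinuousOn (a i) (Icc 0 T)) {d : ℝ → ℝ}
    (hd : ContinuousOn d (Icc 0 T)) (h : ∀ t ∈ Icc 0 T, d t = -opA m α a d t) :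
    ∀ t ∈ Icc 0 T, d t = 0 := by
  obtain ⟨lam, hlam, hA⟩ := exists_opA_weighted_bound hα ha
  obtain ⟨M, hM0, hM⟩ := exists_exp_bound hlam.le hd
  have key : ∀ k : ℕ, ∀ t ∈ Icc 0 T, |d t| ≤ M * (1 / 2) ^ k * Real.exp (lam * t) := by
    intro k
    induction k with
    | zero => simpa using hM
    | succ k ih =>
      intro t ht
      rw [h t ht, abs_neg]
      refine (hA _ _ (by positivity) ih t ht).trans_eq ?_
      rw [pow_succ]
      ring
  intro t ht
  have hlim : Tendsto (fun k : ℕ => M * (1 / 2 : ℝ) ^ k * Real.exp (lam * t)) atTop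
      (𝓝 (M * 0 * Real.exp (lam * t))) :=
    ((tendsto_pow_atTop_nhds_zero_of_lt_one (by norm_num) (by norm_num)).const_mul M).mul_const _
  rw [mul_zero, zero_mul] at hlim
  exact abs_nonpos_iff.1 (ge_of_tendsto' hlim fun k => key k t ht)

/-- The Neumann series solves the Volterra equation `v = -(g + opA v)`. -/
theorem exists_neumann_series (hα : ∀ i ∈ Icc 1 m, α i < α 0)
    (ha : ∀ i ∈ Icc 1 m, ContinuousOn (a i) (Icc 0 T)) {g : ℝ → ℝ}
    (hg : ContinuousOn g (Icc 0 T)) :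
    ∃ v : ℝ → ℝ, ContinuousOn v (Icc 0 T) ∧
      TendstoUniformlyOn
        (fun N t => ∑ k ∈ Finset.range N, (-1) ^ (k + 1) * (opA m α a)^[k] g t) v atTop (Icc 0 T) ∧
      EqOn v (fun t => -(g t + opA m α a v t)) (Icc 0 T) := by
  obtain ⟨C, hC, hb⟩ := exists_opA_iterate_bound hα ha hg
  have hcont := continuousOn_opA_iterate hα ha hg
  have hpc : ∀ N, ContinuousOn
      (fun t => ∑ k ∈ Finset.range N, (-1) ^ (k + 1) * (opA m α a)^[k] g t) (Icc 0 T) :=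
    fun N => continuousOn_finsetSum _ fun k _ => continuousOn_const.mul (hcont k)
  have hunif := tendstoUniformlyOn_tsum_nat (s := Icc 0 T)
    (f := fun k t => (-1) ^ (k + 1) * (opA m α a)^[k] g t) (u := fun k => C * (1 / 2) ^ k)
    ((summable_geometric_of_lt_one (by norm_num) (by norm_num)).mul_left C)
    (fun k t ht => by simpa using hb k t ht)
  have hvc := hunif.continuousOn (Frequently.of_forall hpc)
  refine ⟨_, hvc, hunif, fun t ht => ?_⟩
  -- The partial sums satisfy `S (N + 1) = -(g + opA (S N))`; let `N → ∞` on both sides.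
  have h1 := (hunif.tendsto_at ht).comp (tendsto_add_atTop_nat 1)
  have h2 := ((tendsto_opA (a := a) hα hpc hvc hunif ht).const_add (g t)).neg
  refine tendsto_nhds_unique h1 (h2.congr fun N => ?_)
  rw [opA_sum hα hcont ht, Function.comp_apply, Finset.sum_range_succ']
  simp only [← Function.iterate_succ_apply' (opA m α a), pow_succ, Function.iterate_zero_apply,
    neg_add, ← Finset.sum_neg_distrib]
  rw [add_comm]
  congr 1
  · refine Finset.sum_congr rfl fun k _ => ?_
    ring
  · simp

end Volterra

/-! ### Solutions of the equation versus Volterra densities. -/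

section Solutions

variable {T : ℝ} {m j : ℕ} {α : ℕ → ℝ} {a : ℕ → ℝ → ℝ}

/-- The combination `∑ a_i ᶜD^{α_i} Φ_{j+1}` of Caputo derivatives of `Phi j`. -/
noncomputable def caputoPhiSum (m : ℕ) (α : ℕ → ℝ) (a : ℕ → ℝ → ℝ) (j : ℕ) (t : ℝ) : ℝ :=
  ∑ i ∈ Finset.Icc 1 m, a i t * caputoPhi j (α i) t

theorem continuousOn_caputoPhiSum (ha : ∀ i ∈ Icc 1 m, ContinuousOn (a i) (Icc 0 T)) :
    ContinuousOn (caputoPhiSum m α a j) (Icc 0 T) :=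
  continuousOn_finsetSum _ fun i hi =>
    (ha i (Finset.mem_Icc.1 hi)).mul (continuousOn_caputoPhi T j (α i))

theorem sum_caputoDeriv_of_eqOn_Phi_add (hT : 0 < T) (hα : ∀ i ∈ Icc 1 m, α i < α 0)
    (hα0 : ∀ i ≤ m, 0 ≤ α i) {w F : ℝ → ℝ} (hw : ContinuousOn w (Icc 0 T))
    (hF : EqOn F (fun t => Phi j t + fracInt (α 0) w t) (Icc 0 T)) {t : ℝ} (ht : t ∈ Ioc 0 T) :
    ∑ i ∈ Finset.Icc 1 m, a i t * caputoDeriv T (α i) F t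
      = caputoPhiSum m α a j t + opA m α a w t := by
  rw [caputoPhiSum, opA, ← Finset.sum_add_distrib]
  refine Finset.sum_congr rfl fun i hi => ?_
  rw [Finset.mem_Icc] at hi
  rw [(caputoDeriv_of_eqOn_Phi_add hT hw hF (hα0 i hi.2) (hα i hi).le).2 ht, mul_add]

theorem isSolution_of_eqOn_Phi_add (hT : 0 < T) (hα : ∀ i ∈ Icc 1 m, α i < α 0)
    (hα0 : ∀ i ≤ m, 0 ≤ α i) (hj : (j : ℝ) < α 0) {w F : ℝ → ℝ}
    (hw : ContinuousOn w (Icc 0 T))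
    (hF : EqOn F (fun t => Phi j t + fracInt (α 0) w t) (Icc 0 T))
    (h : EqOn w (fun t => -(caputoPhiSum m α a j t + opA m α a w t)) (Icc 0 T)) :
    IsSolution T m α a F := by
  refine ⟨fun i hi k hk t ht => ?_, fun t ht => ?_⟩
  · have hi0 : α i ≤ α 0 := by
      rcases i.eq_zero_or_pos with rfl | h1
      · exact le_rfl
      · exact (hα i ⟨h1, hi⟩).le
    exact (caputoDeriv_of_eqOn_Phi_add hT hw hF (hα0 i hi) hi0).1 k hk t (Ioo_subset_Ioc_self ht)
  · have ht' := Ioo_subset_Ioc_self ht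
    rw [(memCaputoSpace_of_eqOn_Phi_add (r := 0) hT (hα0 0 m.zero_le) hw hF hj
      (by simpa using hα0 0 m.zero_le)).2 ht',
      sum_caputoDeriv_of_eqOn_Phi_add hT hα hα0 hw hF ht', h (Ioc_subset_Icc_self ht')]

theorem exists_density_of_isSolution (hT : 0 < T) (hα : ∀ i ∈ Icc 1 m, α i < α 0)
    (hα0 : ∀ i ≤ m, 0 ≤ α i) (ha : ∀ i ∈ Icc 1 m, ContinuousOn (a i) (Icc 0 T))
    {r : ℕ} (hr : ⌈α 0⌉₊ = r + 1) (hj : j < ⌈α 0⌉₊) {z : ℝ → ℝ} (hz : IsSolution T m α a z)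
    (hzm : MemCaputoSpace T (α 0) r z)
    (h0 : ∀ k < ⌈α 0⌉₊, iteratedDerivWithin k z (Icc 0 T) 0 = if j = k then 1 else 0) :
    ∃ w : ℝ → ℝ, ContinuousOn w (Icc 0 T) ∧
      EqOn z (fun t => Phi j t + fracInt (α 0) w t) (Icc 0 T) ∧
      EqOn w (fun t => -(caputoPhiSum m α a j t + opA m α a w t)) (Icc 0 T) := by
  obtain ⟨hzc, hzd, w, hw, hzw⟩ := hzm
  have hF := eqOn_Phi_add_fracInt_of_caputoDeriv hT hr hj hzc hzd hw hzw h0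
  refine ⟨w, hw, hF, ?_⟩
  have hIoo : EqOn w (fun t => -(caputoPhiSum m α a j t + opA m α a w t)) (Ioo 0 T) := by
    intro t ht
    have ht' := Ioo_subset_Ioc_self ht
    rw [← hzw t ht', hz.2 t ht, sum_caputoDeriv_of_eqOn_Phi_add hT hα hα0 hw hF ht']
  -- The differential equation is known only on the open interval; continuity of both sides carries
  -- the Volterra equation to the endpoints.
  exact hIoo.of_subset_closure hw
    ((continuousOn_caputoPhiSum ha).add (continuousOn_opA hα ha hw)).neg Ioo_subset_Icc_self
    (closure_Ioo hT.ne).ge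

theorem volterra_unique (hα : ∀ i ∈ Icc 1 m, α i < α 0)
    (ha : ∀ i ∈ Icc 1 m, ContinuousOn (a i) (Icc 0 T)) {g v w : ℝ → ℝ}
    (hv : ContinuousOn v (Icc 0 T)) (hw : ContinuousOn w (Icc 0 T))
    (hve : EqOn v (fun t => -(g t + opA m α a v t)) (Icc 0 T))
    (hwe : EqOn w (fun t => -(g t + opA m α a w t)) (Icc 0 T)) : EqOn v w (Icc 0 T) := by
  intro t ht
  refine sub_eq_zero.1 (eqOn_zero_of_eqOn_neg_opA (d := fun s => v s - w s) hα ha (hv.sub hw)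
    (fun s hs => ?_) t ht)
  rw [opA_sub hα hv hw hs, hve hs, hwe hs]
  have h1 := hve hs
  have h2 := hwe hs
  simp only at h1 h2
  linarith

/-- Since `α` decreases, `α i ≤ j` for all `i ≥ h_j`, where both derivatives of `Phi j` agree. By
minimality `α i > j` below `h_j`, where the Caputo derivative is zero. -/
theorem sum_PhiFrac_eq_caputoPhiSum (hα : ∀ i j : ℕ, i < j → j ≤ m → α j < α i)
    (hα0 : ∀ i ≤ m, 0 ≤ α i) (hH : (H m α j).Nonempty) :
    EqOn (fun t => ∑ i ∈ Finset.Icc (h m α j) m, a i t * PhiFrac T j (α i) t)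
      (caputoPhiSum m α a j) (Ioc 0 T) := by
  obtain ⟨⟨hp1, hpm⟩, -, hpj⟩ : h m α j ∈ H m α j := Nat.sInf_mem hH
  intro t ht
  simp only [caputoPhiSum]
  rw [← Finset.sum_subset (Finset.Icc_subset_Icc_left hp1)]
  · refine Finset.sum_congr rfl fun i hi => ?_
    rw [Finset.mem_Icc] at hi
    have hij : α i ≤ j := by
      rcases hi.1.eq_or_lt with h | h
      · rwa [← h]
      · exact (hα _ _ h hi.2).le.trans hpj
    rw [PhiFrac_eq_caputoPhi (hα0 i hi.2) hij ht]
  · intro i hi hip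
    rw [Finset.mem_Icc] at hi hip
    have hlt : (j : ℝ) < α i := by
      by_contra hle
      exact hip ⟨Nat.sInf_le ⟨hi, hα0 i hi.2, not_lt.1 hle⟩, hi.2⟩
    rw [caputoPhi, if_pos hlt, mul_zero]

theorem seriesTerm_eq_fracInt {p k : ℕ} {g : ℝ → ℝ} (hα : ∀ i ∈ Icc 1 m, α i < α 0)
    (hα0 : 0 < α 0)
    (hg : EqOn (fun t => ∑ i ∈ Finset.Icc p m, a i t * PhiFrac T j (α i) t) g (Ioc 0 T)) :
    EqOn (seriesTerm T m α a p j k)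
      (fracInt (α 0) fun s => (-1) ^ (k + 1) * (opA m α a)^[k] g s) (Icc 0 T) := by
  intro t ht
  rw [seriesTerm, fracInt_const_mul, fracInt_congr_Ioc hα0 (opA_iterate_congr_Ioc hα hg k) ht]

/-- Every part of the norm reduces to uniform convergence of the densities `V N → v`: the Caputo
derivatives are the densities, and the `k`-th derivatives differ by `fracInt (α 0 - k)` of their
difference. -/
theorem isSeries_of_neumann_series (hT : 0 < T) (hα : ∀ i ∈ Icc 1 m, α i < α 0)
    (ha : ∀ i ∈ Icc 1 m, ContinuousOn (a i) (Icc 0 T)) (hj : (j : ℝ) < α 0) {p r : ℕ}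
    (hr : (r : ℝ) ≤ α 0) {g v : ℝ → ℝ} (hg : ContinuousOn g (Icc 0 T))
    (hpg : EqOn (fun t => ∑ i ∈ Finset.Icc p m, a i t * PhiFrac T j (α i) t) g (Ioc 0 T))
    (hv : ContinuousOn v (Icc 0 T))
    (hlim : TendstoUniformlyOn
      (fun N t => ∑ k ∈ Finset.range N, (-1) ^ (k + 1) * (opA m α a)^[k] g t) v atTop (Icc 0 T)) :
    IsSeries T m α a r p j (fun t => Phi j t + fracInt (α 0) v t) := by
  have hA : 0 < α 0 := j.cast_nonneg.trans_lt hj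
  obtain ⟨C, hC, hb⟩ := exists_opA_iterate_bound hα ha hg
  set V : ℕ → ℝ → ℝ := fun N t => ∑ k ∈ Finset.range N, (-1) ^ (k + 1) * (opA m α a)^[k] g t
    with hV
  have hcont : ∀ k, ContinuousOn (fun t => (-1) ^ (k + 1) * (opA m α a)^[k] g t) (Icc 0 T) :=
    fun k => continuousOn_const.mul (continuousOn_opA_iterate hα ha hg k)
  have hVc : ∀ N, ContinuousOn (V N) (Icc 0 T) :=
    fun N => continuousOn_finsetSum _ fun k _ => hcont k
  have hsum : ∀ N, ∀ t ∈ Icc 0 T,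
      ∑ k ∈ Finset.range N, seriesTerm T m α a p j k t = fracInt (α 0) (V N) t := by
    intro N t ht
    rw [hV, fracInt_sum hA.le hcont ht]
    exact Finset.sum_congr rfl fun k _ => seriesTerm_eq_fracInt hα hA hpg ht
  have hF : ∀ N, EqOn (fun t => Phi j t + ∑ k ∈ Finset.range N, seriesTerm T m α a p j k t)
      (fun t => Phi j t + fracInt (α 0) (V N) t) (Icc 0 T) := fun N t ht => by
    simp only [hsum N t ht]
  have hy : EqOn (fun t => Phi j t + fracInt (α 0) v t)
      (fun t => Phi j t + fracInt (α 0) v t) (Icc 0 T) := fun _ _ => rfl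
  have hFm := fun N => memCaputoSpace_of_eqOn_Phi_add hT hA.le (hVc N) (hF N) hj hr
  have hym := memCaputoSpace_of_eqOn_Phi_add hT hA.le hv hy hj hr
  refine ⟨fun t ht => ?_, fun N => (hFm N).1, hym.1, fun k hk => ?_, ?_⟩
  · have hs : Summable fun k => seriesTerm T m α a p j k t := by
      refine Summable.of_norm_bounded (g := fun k => C * (1 / 2) ^ k * Real.exp T)
        (((summable_geometric_of_lt_one (by norm_num) (by norm_num)).mul_left C).mul_right _)
        fun k => ?_
      rw [seriesTerm_eq_fracInt hα hA hpg ht]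
      exact abs_fracInt_le_of_bound hA.le (by positivity)
        (fun s hs => by simpa using hb k s hs) ht
    refine ⟨hs, ?_⟩
    refine congrArg (Phi j t + ·) ?_
    refine tendsto_nhds_unique ((tendstoUniformlyOn_fracInt hA.le hVc hv hlim).tendsto_at ht) ?_
    exact hs.hasSum.tendsto_sum_nat.congr fun N => hsum N t ht
  · have hkA : (k : ℝ) ≤ α 0 := (Nat.cast_le.2 hk).trans hr
    have h1 := tendstoUniformlyOn_fracInt (sub_nonneg.2 hkA) hVc hv hlim
    rw [Metric.tendstoUniformlyOn_iff] at h1 ⊢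
    intro ε hε
    filter_upwards [h1 ε hε] with N hN t ht
    rw [iteratedDerivWithin_of_eqOn_Phi_add hT hv hy hkA ht,
      iteratedDerivWithin_of_eqOn_Phi_add hT (hVc N) (hF N) hkA ht]
    simpa using hN t ht
  · rw [Metric.tendstoUniformlyOn_iff] at hlim ⊢
    intro ε hε
    filter_upwards [hlim ε hε] with N hN t ht
    rw [hym.2 ht, (hFm N).2 ht]
    exact hN t (Ioc_subset_Icc_self ht)

theorem tendsto_nhdsGT_zero_of_continuousOn (hT : 0 < T) {f : ℝ → ℝ}
    (hf : ContinuousOn f (Icc 0 T)) : Tendsto f (𝓝[>] 0) (𝓝 (f 0)) := by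
  rw [← nhdsWithin_Ioc_eq_nhdsGT hT]
  exact (hf 0 ⟨le_rfl, hT.le⟩).mono_left (nhdsWithin_mono _ Ioc_subset_Icc_self)

end Solutions

end CaputoODE

/-! ### The main theorem. -/

theorem theorem2 (T : ℝ) (hT : 0 < T) (m : ℕ) (α : ℕ → ℝ) (n : ℕ → ℕ) (a : ℕ → ℝ → ℝ)
    (hα : ∀ i j : ℕ, i < j → j ≤ m → α j < α i)
    (hαm : 0 ≤ α m)
    (hn : ∀ i ≤ m, (n i : ℝ) - 1 < α i ∧ α i ≤ (n i : ℝ))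
    (hn01 : n 1 < n 0)
    (ha : ∀ i ∈ Set.Icc 1 m, ContinuousOn (a i) (Set.Icc 0 T))
    (hH0 : (CaputoODE.H m α 0).Nonempty) :
    ∃ y : Fin (n 0) → ℝ → ℝ,
      (CaputoODE.IsCanonicalFundamentalSystem T m α a y ∧
        ∀ j, CaputoODE.MemCaputoSpace T (α 0) (n 0 - 1) (y j)) ∧
      (∀ z : Fin (n 0) → ℝ → ℝ,
        CaputoODE.IsCanonicalFundamentalSystem T m α a z →
        (∀ j, CaputoODE.MemCaputoSpace T (α 0) (n 0 - 1) (z j)) →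
        ∀ j, Set.EqOn (z j) (y j) (Set.Icc 0 T)) ∧
      (∀ j : Fin (n 0), (j : ℕ) < n 1 →
        CaputoODE.IsSeries T m α a (n 0 - 1) (CaputoODE.h m α j) j (y j)) ∧
      (∀ j : Fin (n 0), n 1 ≤ (j : ℕ) →
        CaputoODE.IsSeries T m α a (n 0 - 1) 1 j (y j)) := by

  have hα0 : ∀ i ≤ m, 0 ≤ α i := fun i hi => by
    rcases hi.eq_or_lt with rfl | hi
    · exact hαm
    · exact hαm.trans (hα i m hi le_rfl).le
  have hα1 : ∀ i ∈ Set.Icc 1 m, α i < α 0 := fun i hi => hα 0 i hi.1 hi.2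
  have hH : ∀ j : ℕ, (CaputoODE.H m α j).Nonempty := fun j => by
    obtain ⟨i, hi, h0, h1⟩ := hH0
    exact ⟨i, hi, h0, h1.trans (by simp)⟩
  have hm : 1 ≤ m := by
    obtain ⟨i, hi, -⟩ := hH0
    exact hi.1.trans hi.2
  obtain ⟨r, hr⟩ : ∃ r, n 0 = r + 1 := ⟨n 0 - 1, by omega⟩
  have hceil : ⌈α 0⌉₊ = n 0 := by
    rw [Nat.ceil_eq_iff (by omega), Nat.cast_sub (by omega), Nat.cast_one]
    exact hn 0 m.zero_le
  have hlt : ∀ k < n 0, (k : ℝ) < α 0 := fun k hk => Nat.lt_ceil.1 (hceil ▸ hk)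
  have hrA : (r : ℝ) ≤ α 0 := (hlt r (by omega)).le
  have hex := fun j : Fin (n 0) => CaputoODE.exists_neumann_series hα1 ha
    (CaputoODE.continuousOn_caputoPhiSum (α := α) (j := j) ha)
  choose v hv hlim hve using hex
  have hy : ∀ j : Fin (n 0), Set.EqOn
      (fun t => CaputoODE.Phi j t + CaputoODE.fracInt (α 0) (v j) t)
      (fun t => CaputoODE.Phi j t + CaputoODE.fracInt (α 0) (v j) t) (Set.Icc 0 T) :=
    fun _ _ _ => rfl
  have hser : ∀ j : Fin (n 0), CaputoODE.IsSeries T m α a r (CaputoODE.h m α j) j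
      (fun t => CaputoODE.Phi j t + CaputoODE.fracInt (α 0) (v j) t) := fun j =>
    CaputoODE.isSeries_of_neumann_series hT hα1 ha (hlt j j.2) hrA
      (CaputoODE.continuousOn_caputoPhiSum ha)
      (CaputoODE.sum_PhiFrac_eq_caputoPhiSum hα hα0 (hH j)) (hv j) (hlim j)
  have hr' : n 0 - 1 = r := by omega
  rw [hr']
  refine ⟨fun j t => CaputoODE.Phi j t + CaputoODE.fracInt (α 0) (v j) t, ⟨fun j => ⟨?_, ?_⟩, ?_⟩,
    ?_, fun j _ => hser j, fun j hj => ?_⟩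
  · exact CaputoODE.isSolution_of_eqOn_Phi_add hT hα1 hα0 (hlt j j.2) (hv j) (hy j) (hve j)
  · intro k
    have h1 := CaputoODE.iteratedDerivWithin_zero_of_eqOn_Phi_add hT (hv j) (hy j) (hlt k k.2)
    simp only [Fin.ext_iff]
    rw [← h1]
    exact CaputoODE.tendsto_nhdsGT_zero_of_continuousOn hT
      ((CaputoODE.contDiffOn_of_eqOn_Phi_add hT (hv j) (hy j)
        (hlt k k.2).le).continuousOn_iteratedDerivWithin le_rfl (uniqueDiffOn_Icc hT))
  · exact fun j => (CaputoODE.memCaputoSpace_of_eqOn_Phi_add hT (hα0 0 m.zero_le) (hv j) (hy j)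
      (hlt j j.2) hrA).1
  · intro z hz hzm j t ht
    -- Since `z j` is `C^r` up to `0`, its limits at `+0` are its one-sided derivatives there.
    have h0 : ∀ k < ⌈α 0⌉₊,
        iteratedDerivWithin k (z j) (Set.Icc 0 T) 0 = if (j : ℕ) = k then 1 else 0 := by
      intro k hk
      have hk' : k < n 0 := hceil ▸ hk
      have hkr : k ≤ r := by omega
      have h1 := (hz j).2 ⟨k, hk'⟩
      simp only [Fin.ext_iff] at h1
      exact tendsto_nhds_unique (CaputoODE.tendsto_nhdsGT_zero_of_continuousOn hT
        ((hzm j).1.continuousOn_iteratedDerivWithin (by exact_mod_cast hkr) (uniqueDiffOn_Icc hT))) h1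
    obtain ⟨w, hw, hzw, hwe⟩ := CaputoODE.exists_density_of_isSolution hT hα1 hα0 ha
      (hceil.trans hr) (j.2.trans_eq hceil.symm) (hz j).1 (hzm j) h0
    have hwv := CaputoODE.volterra_unique hα1 ha hw (hv j) hwe (hve j)
    simp only [hzw ht, CaputoODE.fracInt_congr (hα0 0 m.zero_le) hwv ht]
  -- Here `α 1 ≤ n 1 ≤ j`, so the full inner sum is the case `h_j = 1` of the truncated one.
  · have h1 : CaputoODE.h m α j = 1 := by
      refine le_antisymm (Nat.sInf_le ⟨⟨le_rfl, hm⟩, hα0 1 hm, ?_⟩) (Nat.sInf_mem (hH j)).1.1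
      exact (hn 1 hm).2.trans (Nat.cast_le.2 hj)
    exact h1 ▸ hser j
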